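/- Let $\Bbbk$ be an algebraically closed field of characteristic $0$, let $n\ge 2$ and $0\le t\le n-1$ be integers, and let $\xi\in\Bbbk$ be a primitive $n$-th root of unity. Let $H=H(n,t,\xi)$ be the Hopf algebra generated as an algebra by $g,x$ with relations $g^n=1$ and $xg=\xi gx$, and with $$\Delta(g)=g\otimes g,\quad \Delta(x)=x\otimes g^t+1\otimes x,\quad \varepsilon(g)=1,\quad \varepsilon(x)=0,\quad S(g)=g^{-1},\quad S(x)=-xg^{-t}.$$ For $i,j\in\mathbb Z$ define elements $c(k,l)=c_j^{ti}(k,l)\in H$, $0\le l\le k$, by $c(0,0)=g^{ti}$ and $$c(k+1,l)=\begin{cases} c(k,0)S(x)+\xi^{tj}\,x\,c(k,0)S(g^t), & l=0,\\ c(k,l)S(x)+\xi^{t(j-l)}\,x\,c(k,l)S(g^t)+c(k,l-1)S(g^t), & 0<l<k+1,\\ c(k,k)S(g^t), & l=k+1.\end{cases}$$ For $0\ne\lambda\in\Bbbk$ let $V(ti,j,\lambda)$ be the left-left Yetter–Drinfeld module over $H$ with $\Bbbk$-basis $v_0,\dots,v_{n-1}$ and $$g\cdot v_k=\xi^{j-k}v_k,\qquad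 x\cdot v_k=v_{k+1}\ (0\le k<n-1),\qquad x\cdot v_{n-1}=\lambda v_0,\qquad \delta(v_k)=\sum_{l=0}^{k}c_j^{ti}(k,l)\otimes v_l .$$ For a Yetter–Drinfeld module $V$ over $H$, equip the tensor algebra $T(V)$ with its induced action and coaction of $H$, and with the braided comultiplication: $\Delta:T(V)\to T(V)\otimes T(V)$ is the algebra map with $\Delta(v)=v\otimes 1+1\otimes v$ for $v\in V$, where $T(V)\otimes T(V)$ has the product $(a\otimes b)(a'\otimes b')=a\,(b_{(-1)}\cdot a')\otimes b_{(0)}b'$. For $m\ge 1$ let $\Delta_{1^m}:V^{\otimes m}\to V^{\otimes m}$ be the restriction to $V^{\otimes m}\subset T(V)$ of $\pi_1^{\otimes m}\circ\Delta^{m-1}$, where $\Delta^{m-1}:T(V)\to T(V)^{\otimes m}$ is the iterated comultiplication and $\pi_1:T(V)\to V$ is the projection onto degree $1$. The Nichols algebra of $V$ is $\mathcal B(V)=T(V)/\bigoplus_{m\ge 2}\ker\Delta_{1^m}$. Suppose $1\le t\le n-1$. Then, for all $i,j\in\mathbb Z$ and all $0\ne\lambda\in\Bbbk$, the Nichols algebra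 $\mathcal B(V(ti,j,\lambda))$ is infinite-dimensional. Moreover, if $0\le i\le n-1$, then for every $m\ge 1$ the coefficient of $v_i\otimes\cdots\otimes v_i$ ($m$ factors) in $\Delta_{1^m}(v_i\otimes\cdots\otimes v_i)$, with respect to the basis of $V^{\otimes m}$ induced by $v_0,\dots,v_{n-1}$, equals $m!$ (in particular it is nonzero). -/

import Mathlib

open scoped TensorProduct

noncomputable section

section YetterDrinfeld

variable (k H V : Type*) [Field k] [Ring H] [HopfAlgebra k H]
  [AddCommGroup V] [Module k V] [Module H V] [IsScalarTower k H V]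

/-- The linear map `H → End (H ⊗ V)` sending `h` to the operator
`a ⊗ v ↦ h₍₁₎ a S(h₍₃₎) ⊗ h₍₂₎ • v`. -/
def ydOperator : H →ₗ[k] Module.End k (H ⊗[k] V) :=
  let F₁ : H →ₗ[k] Module.End k (H ⊗[k] V) :=
    LinearMap.rTensorHom V ∘ₗ LinearMap.mul k H
  let F₂ : H →ₗ[k] Module.End k (H ⊗[k] V) :=
    LinearMap.lTensorHom H ∘ₗ (Algebra.lsmul k k V : H →ₐ[k] Module.End k V).toLinearMap
  let F₃ : H →ₗ[k] Module.End k (H ⊗[k] V) :=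
    LinearMap.rTensorHom V ∘ₗ (LinearMap.mul k H).flip ∘ₗ HopfAlgebra.antipode k
  LinearMap.mul' k (Module.End k (H ⊗[k] V)) ∘ₗ
    TensorProduct.map F₁ (LinearMap.mul' k (Module.End k (H ⊗[k] V)) ∘ₗ
      TensorProduct.map F₂ F₃ ∘ₗ Coalgebra.comul) ∘ₗ Coalgebra.comul

end YetterDrinfeld

/-- `ydOperator` is multiplicative. -/
theorem ydOperator_mul {k H V : Type*} [Field k] [Ring H] [HopfAlgebra k H]
    [AddCommGroup V] [Module k V] [Module H V] [IsScalarTower k H V]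
    (a b : H) :
    ydOperator k H V (a * b) = ydOperator k H V a * ydOperator k H V b := by
  let F₁ : H →ₗ[k] Module.End k (H ⊗[k] V) :=
    LinearMap.rTensorHom V ∘ₗ LinearMap.mul k H
  let F₂ : H →ₗ[k] Module.End k (H ⊗[k] V) :=
    LinearMap.lTensorHom H ∘ₗ (Algebra.lsmul k k V : H →ₐ[k] Module.End k V).toLinearMap
  let F₃ : H →ₗ[k] Module.End k (H ⊗[k] V) :=
    LinearMap.rTensorHom V ∘ₗ (LinearMap.mul k H).flip ∘ₗ HopfAlgebra.antipode k
  let R : H ⊗[k] H →ₗ[k] Module.End k (H ⊗[k] V) :=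
    LinearMap.mul' k (Module.End k (H ⊗[k] V)) ∘ₗ TensorProduct.map F₂ F₃
  have hR : ∀ p q p' q' : H, R ((p * p') ⊗ₜ (q * q')) = R (p ⊗ₜ q) * R (p' ⊗ₜ q') := by
    intro p q p' q'
    refine TensorProduct.ext' fun u v => ?_
    simp [R, F₂, F₃, HopfAlgebra.antipode_mul_antidistrib, mul_assoc]
  have hR2 : ∀ z w : H ⊗[k] H, R (z * w) = R z * R w := by
    intro z w
    induction z using TensorProduct.induction_on with
    | zero => simp
    | add x y hx hy => simp only [add_mul, map_add, hx, hy]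
    | tmul p q =>
      induction w using TensorProduct.induction_on with
      | zero => simp
      | add x y hx hy => simp only [mul_add, map_add, hx, hy]
      | tmul p' q' => rw [Algebra.TensorProduct.tmul_mul_tmul, hR p q p' q']
  have hcomm : ∀ (p : H) (z : H ⊗[k] H), R z * F₁ p = F₁ p * R z := by
    intro p z
    induction z using TensorProduct.induction_on with
    | zero => simp
    | add x y hx hy => simp only [add_mul, mul_add, map_add, hx, hy]
    | tmul p' q' =>
      refine TensorProduct.ext' fun u v => ?_
      simp [R, F₁, F₂, F₃, mul_assoc]
  have h1 : ∀ p p' : H, F₁ (p * p') = F₁ p * F₁ p' := by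
    intro p p'
    refine TensorProduct.ext' fun u v => ?_
    simp [F₁, mul_assoc]
  let Q : H ⊗[k] H →ₗ[k] Module.End k (H ⊗[k] V) :=
    LinearMap.mul' k (Module.End k (H ⊗[k] V)) ∘ₗ TensorProduct.map F₁ (R ∘ₗ Coalgebra.comul)
  have hQ : ∀ z w : H ⊗[k] H, Q (z * w) = Q z * Q w := by
    intro z w
    induction z using TensorProduct.induction_on with
    | zero => simp
    | add x y hx hy => simp only [add_mul, map_add, hx, hy]
    | tmul p q =>
      induction w using TensorProduct.induction_on with
      | zero => simp
      | add x y hx hy => simp only [mul_add, map_add, hx, hy]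
      | tmul p' q' =>
        simp only [Q, Algebra.TensorProduct.tmul_mul_tmul, LinearMap.comp_apply,
          TensorProduct.map_tmul, LinearMap.mul'_apply, Bialgebra.comul_mul, hR2, h1]
        rw [mul_assoc, ← mul_assoc (F₁ p'), ← hcomm]
        simp only [mul_assoc]
  have hop : ∀ h : H, ydOperator k H V h = Q (Coalgebra.comul h) := fun h => rfl
  rw [hop, hop, hop, Bialgebra.comul_mul, hQ]

theorem ydOperator_algebraMap {k H V : Type*} [Field k] [Ring H] [HopfAlgebra k H]
    [AddCommGroup V] [Module k V] [Module H V] [IsScalarTower k H V] (c : k) (z : H ⊗[k] V) :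
    ydOperator k H V (algebraMap k H c) z = c • z := by
  rw [Algebra.algebraMap_eq_smul_one, map_smul, LinearMap.smul_apply]
  congr 1
  have : ydOperator k H V 1 = 1 := by
    refine TensorProduct.ext' fun u v => ?_
    simp [ydOperator, Algebra.TensorProduct.one_def]
  rw [this]; rfl

section YetterDrinfeld

variable (k H V : Type*) [Field k] [Ring H] [HopfAlgebra k H]
  [AddCommGroup V] [Module k V] [Module H V] [IsScalarTower k H V]

/-- A (left-left) Yetter-Drinfeld module structure over the Hopf algebra `H` on the left
`H`-module `V`: a left `H`-comodule structure `δ : V → H ⊗ V` such that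
`δ(h • v) = h₍₁₎ v₍₋₁₎ S(h₍₃₎) ⊗ h₍₂₎ • v₍₀₎`. -/
class YetterDrinfeldModule where
  /-- The coaction `δ`. -/
  coaction : V →ₗ[k] H ⊗[k] V
  coassoc : (TensorProduct.assoc k H H V).toLinearMap ∘ₗ
      (Coalgebra.comul : H →ₗ[k] H ⊗[k] H).rTensor V ∘ₗ coaction =
    coaction.lTensor H ∘ₗ coaction
  counit : (TensorProduct.lid k V).toLinearMap ∘ₗ
      (Coalgebra.counit : H →ₗ[k] k).rTensor V ∘ₗ coaction = LinearMap.id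
  compat : ∀ (h : H) (v : V), coaction (h • v) = ydOperator k H V h (coaction v)

local notation "T" => TensorAlgebra k V

namespace YetterDrinfeldModule

/-- The action of `H` on the tensor algebra `T(V)`, determined by `h · v = h • v` for `v ∈ V`,
`h · 1 = ε(h) 1` and `h · (a b) = (h₍₁₎ · a) (h₍₂₎ · b)`.  The last two rules say that
`a ↦ (h ↦ h · a)` is an algebra map from `T(V)` to the convolution algebra `Hom(H, T(V))`. -/
def tensorAction : T →ₐ[k] WithConv (H →ₗ[k] T) :=
  TensorAlgebra.lift k ((WithConv.linearEquiv k (H →ₗ[k] T)).symm.toLinearMap ∘ₗ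
    LinearMap.llcomp k H V T (TensorAlgebra.ι k) ∘ₗ
      (Algebra.lsmul k k V : H →ₐ[k] Module.End k V).toLinearMap.flip)

/-- The action of `h : H` on `a : T(V)`. -/
def tensorSMul : H →ₗ[k] T →ₗ[k] T :=
  ((WithConv.linearEquiv k (H →ₗ[k] T)).toLinearMap ∘ₗ (tensorAction k H V).toLinearMap).flip

variable {k V} in
theorem tensorSMul_ι (h : H) (v : V) :
    tensorSMul k H V h (TensorAlgebra.ι k v) = TensorAlgebra.ι k (h • v) := by
  simp [tensorSMul, tensorAction]

theorem tensorSMul_one (h : H) :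
    tensorSMul k H V h 1 = algebraMap k T (Coalgebra.counit h) := by
  simp [tensorSMul]

variable {k V} in
theorem tensorSMul_mul (h : H) (a b : T) :
    tensorSMul k H V h (a * b) = LinearMap.mul' k T (TensorProduct.map
      ((tensorSMul k H V).flip a) ((tensorSMul k H V).flip b) (Coalgebra.comul h)) := by
  simp [tensorSMul]

theorem one_tensorSMul (a : T) : tensorSMul k H V 1 a = a := by
  induction a using TensorAlgebra.induction with
  | algebraMap r => simp [Algebra.algebraMap_eq_smul_one, tensorSMul_one]
  | ι v => simp [tensorSMul_ι]
  | add a b ha hb => simp [ha, hb]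
  | mul a b ha hb =>
    simp [tensorSMul_mul, Algebra.TensorProduct.one_def, ha, hb]

theorem mul_tensorSMul (h h' : H) (a : T) :
    tensorSMul k H V (h * h') a = tensorSMul k H V h (tensorSMul k H V h' a) := by
  induction a using TensorAlgebra.induction generalizing h h' with
  | algebraMap r =>
    simp only [Algebra.algebraMap_eq_smul_one, tensorSMul_one, map_smul, Bialgebra.counit_mul,
      mul_smul]
    rw [smul_comm (Coalgebra.counit (R := k) h)]
  | ι v => simp [tensorSMul_ι, mul_smul]
  | add a b ha hb => simp [ha, hb]
  | mul a b ha hb =>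
    rw [tensorSMul_mul H h', tensorSMul_mul H (h * h'), Bialgebra.comul_mul]
    generalize Coalgebra.comul (R := k) h' = z'
    induction z' using TensorProduct.induction_on with
    | zero => simp
    | add x y hx hy => simp [mul_add, hx, hy]
    | tmul p' q' =>
      simp only [TensorProduct.map_tmul, LinearMap.mul'_apply, LinearMap.flip_apply]
      rw [tensorSMul_mul H h]
      generalize Coalgebra.comul (R := k) h = z
      induction z using TensorProduct.induction_on with
      | zero => simp
      | add x y hx hy => simp [add_mul, hx, hy]
      | tmul p q => simp [ha, hb]

variable [YetterDrinfeldModule k H V]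

/-- The coaction of `H` on the tensor algebra `T(V)`: the algebra map `T(V) → H ⊗ T(V)` (ordinary
tensor product of algebras) that extends the coaction of `V`. -/
def tensorCoaction : T →ₐ[k] H ⊗[k] T :=
  TensorAlgebra.lift k ((TensorAlgebra.ι k).lTensor H ∘ₗ coaction)

/-- The braiding `T(V) ⊗ T(V) → T(V) ⊗ T(V)`, `a ⊗ b ↦ a₍₋₁₎ · b ⊗ a₍₀₎`. -/
def tensorBraiding : T ⊗[k] T →ₗ[k] T ⊗[k] T :=
  (TensorProduct.lift (tensorSMul k H V)).rTensor T ∘ₗ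
    (TensorProduct.rightComm k H T T).toLinearMap ∘ₗ
      (tensorCoaction k H V).toLinearMap.rTensor T

/-- The multiplication `(m ⊗ m)(id ⊗ c ⊗ id)` on `T(V) ⊗ T(V)`, where `c` is the braiding. -/
def braidedMul : (T ⊗[k] T) ⊗[k] (T ⊗[k] T) →ₗ[k] T ⊗[k] T :=
  TensorProduct.map (LinearMap.mul' k T) (LinearMap.mul' k T) ∘ₗ
    (TensorProduct.assoc k T T (T ⊗[k] T)).symm.toLinearMap ∘ₗ
    ((TensorProduct.assoc k T T T).toLinearMap ∘ₗ (tensorBraiding k H V).rTensor T ∘ₗ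
      (TensorProduct.assoc k T T T).symm.toLinearMap).lTensor T ∘ₗ
    (TensorProduct.assoc k T T (T ⊗[k] T)).toLinearMap

theorem tensorCoaction_coassoc (a : T) :
    TensorProduct.assoc k H H T
      ((Coalgebra.comul : H →ₗ[k] H ⊗[k] H).rTensor T (tensorCoaction k H V a)) =
    (tensorCoaction k H V).toLinearMap.lTensor H (tensorCoaction k H V a) := by
  let f : T →ₐ[k] H ⊗[k] (H ⊗[k] T) :=
    ((Algebra.TensorProduct.assoc k k k H H T).toAlgHom.comp
      (Algebra.TensorProduct.map (Bialgebra.comulAlgHom k H) (AlgHom.id k T))).comp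
        (tensorCoaction k H V)
  let g : T →ₐ[k] H ⊗[k] (H ⊗[k] T) :=
    (Algebra.TensorProduct.map (AlgHom.id k H) (tensorCoaction k H V)).comp
        (tensorCoaction k H V)
  have hfg : f = g := by
    ext v
    have h := congrArg (((TensorAlgebra.ι k : V →ₗ[k] T).lTensor H).lTensor H)
      (LinearMap.congr_fun (coassoc (k := k) (H := H) (V := V)) v)
    have h1 : tensorCoaction k H V (TensorAlgebra.ι k v) =
        (TensorAlgebra.ι k).lTensor H (coaction (k := k) (H := H) v) := by
      simp [tensorCoaction]
    simp only [f, g, LinearMap.comp_apply, AlgHom.toLinearMap_apply, AlgHom.comp_apply, h1] at h ⊢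
    convert h using 1
    · generalize (coaction (k := k) (H := H) v) = z
      induction z using TensorProduct.induction_on with
      | zero => simp
      | add x y hx hy => simp only [map_add, hx, hy]
      | tmul p q =>
        simp
        generalize Coalgebra.comul (R := k) p = z
        induction z using TensorProduct.induction_on with
        | zero => simp
        | add x y hx hy => simp only [map_add, TensorProduct.add_tmul, hx, hy]
        | tmul p q => simp
    · generalize (coaction (k := k) (H := H) v) = z
      induction z using TensorProduct.induction_on with
      | zero => simp
      | add x y hx hy => simp only [map_add, hx, hy]
      | tmul p q => simp [tensorCoaction]
  exact congrArg (fun F : T →ₐ[k] H ⊗[k] (H ⊗[k] T) => F a) hfg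

theorem tensorCoaction_counit (a : T) :
    TensorProduct.lid k T
      ((Coalgebra.counit : H →ₗ[k] k).rTensor T (tensorCoaction k H V a)) = a := by
  let f : T →ₐ[k] T :=
    ((Algebra.TensorProduct.lid k T).toAlgHom.comp
      (Algebra.TensorProduct.map (Bialgebra.counitAlgHom k H) (AlgHom.id k T))).comp
        (tensorCoaction k H V)
  have hf : f = AlgHom.id k T := by
    ext v
    have h := congrArg (TensorAlgebra.ι k : V →ₗ[k] T)
      (LinearMap.congr_fun (counit (k := k) (H := H) (V := V)) v)
    have h1 : tensorCoaction k H V (TensorAlgebra.ι k v) =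
        (TensorAlgebra.ι k).lTensor H (coaction (k := k) (H := H) v) := by
      simp [tensorCoaction]
    simp only [f, LinearMap.comp_apply, AlgHom.toLinearMap_apply, AlgHom.comp_apply, h1] at h ⊢
    refine Eq.trans ?_ h
    generalize (coaction (k := k) (H := H) v) = z
    induction z using TensorProduct.induction_on with
    | zero => simp
    | add x y hx hy => simp only [map_add, hx, hy]
    | tmul p q => simp
  exact congrArg (fun F : T →ₐ[k] T => F a) hf

/-- `(a ⊗ b)(a' ⊗ b') = a (b₍₋₁₎ · a') ⊗ b₍₀₎ b'`. -/
theorem braidedMul_tmul (a b a' b' : T) :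
    braidedMul k H V ((a ⊗ₜ[k] b) ⊗ₜ[k] (a' ⊗ₜ[k] b')) =
      TensorProduct.map (LinearMap.mulLeft k a ∘ₗ (tensorSMul k H V).flip a')
        (LinearMap.mulRight k b') (tensorCoaction k H V b) := by
  simp only [braidedMul, tensorBraiding, LinearMap.comp_apply, LinearEquiv.coe_coe,
    TensorProduct.assoc_tmul, LinearMap.lTensor_tmul, TensorProduct.assoc_symm_tmul,
    LinearMap.rTensor_tmul, AlgHom.toLinearMap_apply]
  generalize tensorCoaction k H V b = z
  induction z using TensorProduct.induction_on with
  | zero => simp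
  | add x y hx hy => simp only [map_add, TensorProduct.add_tmul, TensorProduct.tmul_add, hx, hy]
  | tmul p q => simp

theorem braidedMul_assoc (x y z : T ⊗[k] T) :
    braidedMul k H V (braidedMul k H V (x ⊗ₜ[k] y) ⊗ₜ[k] z) =
      braidedMul k H V (x ⊗ₜ[k] braidedMul k H V (y ⊗ₜ[k] z)) := by
  induction x using TensorProduct.induction_on with
  | zero => simp
  | add x x' hx hx' => simp only [map_add, TensorProduct.add_tmul, hx, hx']
  | tmul a b =>
  induction y using TensorProduct.induction_on with
  | zero => simp
  | add x x' hx hx' => simp only [map_add, TensorProduct.add_tmul, TensorProduct.tmul_add, hx, hx']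
  | tmul a' b' =>
  induction z using TensorProduct.induction_on with
  | zero => simp
  | add x x' hx hx' => simp only [map_add, TensorProduct.tmul_add, hx, hx']
  | tmul a'' b'' =>
  rw [braidedMul_tmul, braidedMul_tmul]
  -- both sides are a linear function of the two-fold coaction of `b`
  let G : H ⊗[k] T → H ⊗[k] (H ⊗[k] T) →ₗ[k] T ⊗[k] T := fun z' => TensorProduct.lift <|
    LinearMap.mk₂ k (fun h w => TensorProduct.map
        (LinearMap.mulLeft k (a * tensorSMul k H V h a') ∘ₗ (tensorSMul k H V).flip a'')
        (LinearMap.mulRight k b'') (w * z'))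
      (fun h h' w => by
        rw [← LinearMap.add_apply, ← TensorProduct.map_add_left]
        congr 2; ext; simp [mul_add, add_mul, mul_assoc])
      (fun c h w => by
        rw [← LinearMap.smul_apply, ← TensorProduct.map_smul_left]
        congr 2; ext; simp [mul_assoc])
      (fun h w w' => by rw [add_mul, map_add])
      (fun c h w => by rw [smul_mul_assoc, map_smul])
  have hG : ∀ z' h w, G z' (h ⊗ₜ[k] w) = TensorProduct.map
        (LinearMap.mulLeft k (a * tensorSMul k H V h a') ∘ₗ (tensorSMul k H V).flip a'')
        (LinearMap.mulRight k b'') (w * z') := fun z' h w => by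
    simp only [G, TensorProduct.lift.tmul, LinearMap.mk₂_apply]
  have hL : ∀ z : H ⊗[k] T, braidedMul k H V
      ((TensorProduct.map (LinearMap.mulLeft k a ∘ₗ (tensorSMul k H V).flip a')
        (LinearMap.mulRight k b') z) ⊗ₜ[k] (a'' ⊗ₜ[k] b'')) =
      G (tensorCoaction k H V b') ((tensorCoaction k H V).toLinearMap.lTensor H z) := by
    intro z
    induction z using TensorProduct.induction_on with
    | zero => simp
    | add x y hx hy => simp only [map_add, TensorProduct.add_tmul, hx, hy]
    | tmul h t =>
      simp only [TensorProduct.map_tmul, LinearMap.comp_apply, LinearMap.flip_apply,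
        LinearMap.mulLeft_apply, LinearMap.mulRight_apply, braidedMul_tmul, map_mul,
        LinearMap.lTensor_tmul, hG, AlgHom.toLinearMap_apply]
  have hR : ∀ (h' : H) (t' : T) (z : H ⊗[k] T),
      TensorProduct.map (LinearMap.mulLeft k a ∘ₗ
          (tensorSMul k H V).flip (a' * tensorSMul k H V h' a''))
        (LinearMap.mulRight k (t' * b'')) z =
      G (h' ⊗ₜ[k] t') (TensorProduct.assoc k H H T
        ((Coalgebra.comul : H →ₗ[k] H ⊗[k] H).rTensor T z)) := by
    intro h' t' z
    induction z using TensorProduct.induction_on with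
    | zero => simp
    | add x y hx hy => simp only [map_add, hx, hy]
    | tmul h t =>
      simp only [TensorProduct.map_tmul, LinearMap.comp_apply, LinearMap.flip_apply,
        LinearMap.mulLeft_apply, LinearMap.mulRight_apply, LinearMap.rTensor_tmul,
        tensorSMul_mul]
      generalize Coalgebra.comul (R := k) h = w
      induction w using TensorProduct.induction_on with
      | zero => simp
      | add x y hx hy =>
        simp only [map_add, mul_add, TensorProduct.add_tmul, hx, hy]
      | tmul p q =>
        simp [hG, mul_tensorSMul, mul_assoc]
  rw [hL, ← tensorCoaction_coassoc]
  generalize tensorCoaction k H V b' = z'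
  induction z' using TensorProduct.induction_on with
  | zero =>
    have : G 0 = 0 := by ext; simp [hG]
    simp [this]
  | add x y hx hy =>
    have : G (x + y) = G x + G y := by
      refine TensorProduct.ext' fun p q => ?_
      rw [LinearMap.add_apply, hG, hG, hG, mul_add, map_add]
    rw [this, LinearMap.add_apply, hx, hy, map_add, TensorProduct.tmul_add, map_add]
  | tmul h' t' =>
    simp only [TensorProduct.map_tmul, LinearMap.comp_apply, LinearMap.flip_apply,
        LinearMap.mulLeft_apply, LinearMap.mulRight_apply, braidedMul_tmul, hR]

theorem one_braidedMul (x : T ⊗[k] T) : braidedMul k H V ((1 ⊗ₜ[k] 1) ⊗ₜ[k] x) = x := by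
  induction x using TensorProduct.induction_on with
  | zero => simp
  | add x y hx hy => simp only [map_add, TensorProduct.tmul_add, hx, hy]
  | tmul a b =>
    simp [braidedMul_tmul, Algebra.TensorProduct.one_def, one_tensorSMul]

theorem braidedMul_one (x : T ⊗[k] T) : braidedMul k H V (x ⊗ₜ[k] (1 ⊗ₜ[k] 1)) = x := by
  induction x using TensorProduct.induction_on with
  | zero => simp
  | add x y hx hy => simp only [map_add, TensorProduct.add_tmul, hx, hy]
  | tmul a b =>
    rw [braidedMul_tmul]
    conv_rhs => rw [← tensorCoaction_counit k H V b]
    generalize tensorCoaction k H V b = z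
    induction z using TensorProduct.induction_on with
    | zero => simp
    | add x y hx hy => simp only [map_add, TensorProduct.tmul_add, hx, hy]
    | tmul p q => simp [tensorSMul_one, Algebra.algebraMap_eq_smul_one, TensorProduct.smul_tmul]

end YetterDrinfeldModule

open YetterDrinfeldModule

variable [YetterDrinfeldModule k H V]

/-- The braided tensor product algebra of `T(V)` with itself: the vector space `T(V) ⊗ T(V)` with
the multiplication `(a ⊗ b)(a' ⊗ b') = a (b₍₋₁₎ · a') ⊗ b₍₀₎ b'`. -/
@[nolint unusedArguments]
def BraidedTensorSquare (k H V : Type*) [Field k] [Ring H] [HopfAlgebra k H]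
    [AddCommGroup V] [Module k V] [Module H V] [IsScalarTower k H V]
    [YetterDrinfeldModule k H V] : Type _ := TensorAlgebra k V ⊗[k] TensorAlgebra k V

namespace BraidedTensorSquare

instance : AddCommGroup (BraidedTensorSquare k H V) :=
  inferInstanceAs (AddCommGroup (T ⊗[k] T))

instance : Module k (BraidedTensorSquare k H V) :=
  inferInstanceAs (Module k (T ⊗[k] T))

/-- The identity map from the braided tensor square to `T(V) ⊗ T(V)`. -/
def toTensor : BraidedTensorSquare k H V ≃ₗ[k] T ⊗[k] T := LinearEquiv.refl k _

instance : Ring (BraidedTensorSquare k H V) where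
  __ := (inferInstance : AddCommGroup (BraidedTensorSquare k H V))
  one := (toTensor k H V).symm (1 ⊗ₜ[k] 1)
  mul x y := (toTensor k H V).symm
    (braidedMul k H V (toTensor k H V x ⊗ₜ[k] toTensor k H V y))
  left_distrib x y z := (TensorProduct.curry (braidedMul k H V) x).map_add y z
  right_distrib x y z := (TensorProduct.curry (braidedMul k H V)).map_add₂ x y z
  zero_mul x := (TensorProduct.curry (braidedMul k H V)).map_zero₂ x
  mul_zero x := (TensorProduct.curry (braidedMul k H V) x).map_zero
  mul_assoc x y z := braidedMul_assoc k H V x y z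
  one_mul x := one_braidedMul k H V x
  mul_one x := braidedMul_one k H V x

instance : Algebra k (BraidedTensorSquare k H V) :=
  Algebra.ofModule
    (fun c x y => (TensorProduct.curry (braidedMul k H V)).map_smul₂ c x y)
    (fun c x y => (TensorProduct.curry (braidedMul k H V) x).map_smul c y)

end BraidedTensorSquare

/-- The comultiplication of `T(V)`: the algebra map from `T(V)` to the braided tensor product of
`T(V)` with itself such that `Δ(v) = v ⊗ 1 + 1 ⊗ v` for `v ∈ V`. -/
def braidedComulAlgHom : T →ₐ[k] BraidedTensorSquare k H V :=
  TensorAlgebra.lift k ((BraidedTensorSquare.toTensor k H V).symm.toLinearMap ∘ₗ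
    ((TensorProduct.mk k T T).flip 1 + TensorProduct.mk k T T 1) ∘ₗ TensorAlgebra.ι k)

/-- The comultiplication of `T(V)` as a linear map `T(V) → T(V) ⊗ T(V)`. -/
def braidedComul : T →ₗ[k] T ⊗[k] T :=
  (BraidedTensorSquare.toTensor k H V).toLinearMap ∘ₗ (braidedComulAlgHom k H V).toLinearMap

/-- The canonical map `M ⊗ M^{⊗m} → M^{⊗(m+1)}`. -/
def tensorPowerCons (k M : Type*) [Field k] [AddCommGroup M] [Module k M] (m : ℕ) :
    M ⊗[k] (⨂[k]^m M) →ₗ[k] ⨂[k]^(m + 1) M :=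
  (TensorPower.cast k M (Nat.add_comm 1 m)).toLinearMap ∘ₗ
    TensorPower.mulEquiv.toLinearMap ∘ₗ
      (PiTensorProduct.subsingletonEquiv (R := k) (s := fun _ : Fin 1 => M)
        (0 : Fin 1)).symm.toLinearMap.rTensor (⨂[k]^m M)

theorem tensorPowerCons_tprod (k M : Type*) [Field k] [AddCommGroup M] [Module k M] (m : ℕ)
    (x : M) (f : Fin m → M) :
    tensorPowerCons k M m (x ⊗ₜ[k] PiTensorProduct.tprod k f) =
      PiTensorProduct.tprod k (Fin.cons x f : Fin (m + 1) → M) := by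
  have h : (TensorPower.mulEquiv (PiTensorProduct.tprod k (fun _ : Fin 1 => x) ⊗ₜ[k]
      PiTensorProduct.tprod k f) : ⨂[k]^(1 + m) M) =
      PiTensorProduct.tprod k (Fin.append (fun _ : Fin 1 => x) f) :=
    TensorPower.tprod_mul_tprod k _ _
  simp only [tensorPowerCons, LinearMap.comp_apply, LinearMap.rTensor_tmul, LinearEquiv.coe_coe]
  rw [PiTensorProduct.subsingletonEquiv_symm_apply']
  rw [h, TensorPower.cast_tprod]
  congr 1
  rw [Fin.append_left_eq_cons]
  ext i
  simp

/-- The iterated comultiplication `Δ^m : T(V) → T(V)^{⊗(m+1)}`, given by `Δ^0 = id` and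
`Δ^{m+1} = (id ⊗ Δ^m) Δ`. -/
def iteratedComul : (m : ℕ) → (T →ₗ[k] ⨂[k]^(m + 1) T)
  | 0 => (PiTensorProduct.subsingletonEquiv (R := k) (s := fun _ : Fin 1 => T)
      (0 : Fin 1)).symm.toLinearMap
  | m + 1 => tensorPowerCons k T (m + 1) ∘ₗ (iteratedComul m).lTensor T ∘ₗ braidedComul k H V

/-- The map `π₁^{⊗(m+1)} Δ^m : T(V) → V^{⊗(m+1)}`, where `π₁ : T(V) → V` is the projection to the
component of degree one.  Its restriction to the component of degree `m + 1` is `Δ_{1^{m+1}}`. -/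
def deltaOnes (m : ℕ) : T →ₗ[k] ⨂[k]^(m + 1) V :=
  PiTensorProduct.map (fun _ => TensorAlgebra.ιInv) ∘ₗ iteratedComul k H V m

/-- The subspace `⨁_{n ≥ 2} ker Δ_{1^n}` of `T(V)`, where `Δ_{1^n}` is defined on the component
`V^{⊗n}` of degree `n` of `T(V)`. -/
def nicholsKernel : Submodule k T :=
  ⨆ m : ℕ, ⨆ _ : 1 ≤ m,
    LinearMap.range (TensorAlgebra.ι k : V →ₗ[k] T) ^ (m + 1) ⊓ LinearMap.ker (deltaOnes k H V m)

/-- The underlying vector space of the Nichols algebra `B(V) = T(V) / ⨁_{n ≥ 2} ker Δ_{1^n}` -/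
abbrev NicholsAlgebra : Type _ := T ⧸ nicholsKernel k H V

end YetterDrinfeld

section Taft

/-- The parameters of an infinite-dimensional Taft algebra over `k`: integers `n ≥ 2` and
`0 ≤ t ≤ n - 1`, and a primitive `n`-th root of unity `ξ`. -/
structure TaftParameters (k : Type*) [Field k] where
  n : ℕ
  t : ℕ
  ξ : k
  two_le_n : 2 ≤ n
  t_lt_n : t < n
  isPrimitiveRoot : IsPrimitiveRoot ξ n

/-- The generators `g` and `x`. -/
inductive TaftGenerator : Type
  | g
  | x

variable {k : Type*} [Field k] (P : TaftParameters k)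

instance : NeZero P.n := ⟨by have := P.two_le_n; omega⟩

/-- The relations `g ^ n = 1` and `x g = ξ g x`. -/
inductive TaftRelation : FreeAlgebra k TaftGenerator → FreeAlgebra k TaftGenerator → Prop
  | g_pow : TaftRelation (FreeAlgebra.ι k TaftGenerator.g ^ P.n) 1
  | x_mul_g : TaftRelation (FreeAlgebra.ι k TaftGenerator.x * FreeAlgebra.ι k TaftGenerator.g)
      (P.ξ • (FreeAlgebra.ι k TaftGenerator.g * FreeAlgebra.ι k TaftGenerator.x))

/-- The infinite-dimensional Taft algebra `H(n, t, ξ)` as an algebra: generators `g` and `x`,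
relations `g ^ n = 1` and `x g = ξ g x`. -/
def TaftAlgebra : Type _ := RingQuot (TaftRelation P)

namespace TaftAlgebra

instance : Ring (TaftAlgebra P) := inferInstanceAs (Ring (RingQuot (TaftRelation P)))

instance : Algebra k (TaftAlgebra P) :=
  inferInstanceAs (Algebra k (RingQuot (TaftRelation P)))

/-- The generator `g`. -/
def g : TaftAlgebra P := RingQuot.mkAlgHom k (TaftRelation P) (FreeAlgebra.ι k TaftGenerator.g)

/-- The generator `x`. -/
def x : TaftAlgebra P := RingQuot.mkAlgHom k (TaftRelation P) (FreeAlgebra.ι k TaftGenerator.x)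

theorem g_pow_n : g P ^ P.n = 1 := by
  have h := RingQuot.mkAlgHom_rel k (TaftRelation.g_pow (P := P))
  rw [map_pow, map_one] at h
  exact h

theorem x_mul_g : x P * g P = P.ξ • (g P * x P) := by
  have h := RingQuot.mkAlgHom_rel k (TaftRelation.x_mul_g (P := P))
  rw [map_smul, map_mul, map_mul] at h
  exact h

/-- The universal property of `H(n, t, ξ)`. -/
def lift {A : Type*} [Ring A] [Algebra k A] (a b : A) (ha : a ^ P.n = 1)
    (hab : b * a = P.ξ • (a * b)) : TaftAlgebra P →ₐ[k] A :=
  RingQuot.liftAlgHom k ⟨FreeAlgebra.lift k (fun s => TaftGenerator.casesOn s a b), by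
    intro u v huv
    cases huv with
    | g_pow => simp [ha]
    | x_mul_g => simp [hab]⟩

section
variable {A : Type*} [Ring A] [Algebra k A] (a b : A) (ha : a ^ P.n = 1)
    (hab : b * a = P.ξ • (a * b))

@[simp] theorem lift_g : lift P a b ha hab (g P) = a := by
  have h := RingQuot.liftAlgHom_mkAlgHom_apply k
    (FreeAlgebra.lift k (fun s : TaftGenerator => (TaftGenerator.casesOn s a b : A)))
    (s := TaftRelation P) (w := by
      intro u v huv
      cases huv with
      | g_pow => simp [ha]
      | x_mul_g => simp [hab]) (FreeAlgebra.ι k TaftGenerator.g)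
  exact h.trans (FreeAlgebra.lift_ι_apply ..)

@[simp] theorem lift_x : lift P a b ha hab (x P) = b := by
  have h := RingQuot.liftAlgHom_mkAlgHom_apply k
    (FreeAlgebra.lift k (fun s : TaftGenerator => (TaftGenerator.casesOn s a b : A)))
    (s := TaftRelation P) (w := by
      intro u v huv
      cases huv with
      | g_pow => simp [ha]
      | x_mul_g => simp [hab]) (FreeAlgebra.ι k TaftGenerator.x)
  exact h.trans (FreeAlgebra.lift_ι_apply ..)
end

variable {P} in
theorem induction {C : TaftAlgebra P → Prop} (hc : ∀ c : k, C (algebraMap k _ c))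
    (hg : C (g P)) (hx : C (x P)) (hmul : ∀ a b, C a → C b → C (a * b))
    (hadd : ∀ a b, C a → C b → C (a + b)) (a : TaftAlgebra P) : C a := by
  obtain ⟨b, rfl⟩ := RingQuot.mkAlgHom_surjective k (TaftRelation P) a
  induction b using FreeAlgebra.induction with
  | grade0 r => rw [AlgHom.commutes]; exact hc r
  | grade1 s =>
    cases s with
    | g => exact hg
    | x => exact hx
  | mul a b ha hb => rw [map_mul]; exact hmul _ _ ha hb
  | add a b ha hb => rw [map_add]; exact hadd _ _ ha hb

variable {P} in
theorem algHom_ext {A : Type*} [Semiring A] [Algebra k A] {φ ψ : TaftAlgebra P →ₐ[k] A}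
    (hg : φ (g P) = ψ (g P)) (hx : φ (x P) = ψ (x P)) : φ = ψ := by
  ext a
  induction a using induction with
  | hc c => simp
  | hg => exact hg
  | hx => exact hx
  | hmul a b ha hb => simp [ha, hb]
  | hadd a b ha hb => simp [ha, hb]

/-- The invertible element `g`. -/
def gUnit : (TaftAlgebra P)ˣ where
  val := g P
  inv := g P ^ (P.n - 1)
  val_inv := by
    rw [← pow_succ', Nat.sub_add_cancel (NeZero.one_le), g_pow_n]
  inv_val := by
    rw [← pow_succ, Nat.sub_add_cancel (NeZero.one_le), g_pow_n]

/-- The power `g ^ e` for an integer `e`. -/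
def gPow (e : ℤ) : TaftAlgebra P := ((gUnit P ^ e : (TaftAlgebra P)ˣ) : TaftAlgebra P)

theorem gPow_zero : gPow P 0 = 1 := by simp [gPow]

theorem gPow_one : gPow P 1 = g P := by simp [gPow, gUnit]

theorem gPow_natCast (m : ℕ) : gPow P m = g P ^ m := by simp [gPow, gUnit]

theorem gPow_add (a b : ℤ) : gPow P (a + b) = gPow P a * gPow P b := by
  simp [gPow, zpow_add]

theorem gPow_eq_of_dvd {a b : ℤ} (h : (P.n : ℤ) ∣ a - b) : gPow P a = gPow P b := by
  obtain ⟨c, hc⟩ := h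
  have h1 : gUnit P ^ P.n = 1 := by
    ext
    simpa [gUnit] using g_pow_n P
  have : a = P.n * c + b := by linarith
  simp [gPow, this, zpow_add, zpow_mul, h1]

theorem ξ_ne_zero : P.ξ ≠ 0 := P.isPrimitiveRoot.ne_zero (NeZero.ne P.n)

theorem x_mul_gPow (e : ℤ) : x P * gPow P e = P.ξ ^ e • (gPow P e * x P) := by
  induction e using Int.induction_on with
  | zero => simp [gPow_zero]
  | succ m ih =>
    rw [gPow_add, ← mul_assoc, ih, smul_mul_assoc, mul_assoc, gPow_one, x_mul_g, mul_smul_comm,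
      smul_smul, zpow_add_one₀ (ξ_ne_zero P), mul_assoc]
  | pred m ih =>
    have h : gPow P (-m : ℤ) = gPow P (-m - 1) * g P := by
      rw [← gPow_one, ← gPow_add]; congr 1; ring
    rw [h] at ih
    have h2 : g P * gPow P (-1) = 1 := by
      rw [← gPow_one, ← gPow_add, ← gPow_zero]; congr 1
    have h3 := congrArg (· * gPow P (-1)) ih
    have h4 : g P * x P = P.ξ⁻¹ • (x P * g P) := by
      rw [x_mul_g, smul_smul, inv_mul_cancel₀ (ξ_ne_zero P), one_smul]
    simp only [mul_assoc, smul_mul_assoc] at h3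
    rw [h2, mul_one, ← mul_assoc (g P), h4, smul_mul_assoc, mul_assoc, h2, mul_one,
      mul_smul_comm, smul_smul] at h3
    rw [h3, zpow_sub_one₀ (ξ_ne_zero P)]

/-- The comultiplication: `Δ(g) = g ⊗ g` and `Δ(x) = x ⊗ g ^ t + 1 ⊗ x`. -/
def comulHom : TaftAlgebra P →ₐ[k] TaftAlgebra P ⊗[k] TaftAlgebra P :=
  lift P (g P ⊗ₜ g P) (x P ⊗ₜ (g P ^ P.t) + 1 ⊗ₜ x P)
    (by simp [Algebra.TensorProduct.tmul_pow, g_pow_n, Algebra.TensorProduct.one_def])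
    (by
      simp only [add_mul, mul_add, Algebra.TensorProduct.tmul_mul_tmul, x_mul_g, one_mul, mul_one,
        smul_add, TensorProduct.tmul_smul, TensorProduct.smul_tmul']
      rw [← pow_succ, ← pow_succ'])

/-- The counit: `ε(g) = 1` and `ε(x) = 0`. -/
def counitHom : TaftAlgebra P →ₐ[k] k :=
  lift P 1 0 (by simp) (by simp)

instance : Bialgebra k (TaftAlgebra P) :=
  Bialgebra.ofAlgHom (comulHom P) (counitHom P)
    (algHom_ext
      (by simp [comulHom])
      (by simp [comulHom, TensorProduct.add_tmul, TensorProduct.tmul_add, add_assoc,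
            Algebra.TensorProduct.one_def]))
    (algHom_ext
      (by simp [comulHom, counitHom])
      (by simp [comulHom, counitHom]))
    (algHom_ext
      (by simp [comulHom, counitHom])
      (by simp [comulHom, counitHom]))

theorem comul_g : Coalgebra.comul (R := k) (g P) = g P ⊗ₜ[k] g P := lift_g P ..

theorem comul_x : Coalgebra.comul (R := k) (x P) = x P ⊗ₜ[k] (g P ^ P.t) + 1 ⊗ₜ[k] x P :=
  lift_x P ..

theorem counit_g : Coalgebra.counit (R := k) (g P) = 1 := lift_g P ..

theorem counit_x : Coalgebra.counit (R := k) (x P) = 0 := lift_x P ..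

/-- The antipode as an algebra map to the opposite algebra: `S(g) = g⁻¹` and
`S(x) = - x g ^ (-t)`. -/
def antipodeHom : TaftAlgebra P →ₐ[k] (TaftAlgebra P)ᵐᵒᵖ :=
  lift P (MulOpposite.op (gPow P (-1))) (MulOpposite.op (-(x P * gPow P (-P.t))))
    (by
      rw [← MulOpposite.op_pow, ← MulOpposite.op_one]
      congr 1
      rw [gPow, ← Units.val_pow_eq_pow_val, ← zpow_natCast, ← zpow_mul]
      change gPow P _ = 1
      rw [← gPow_zero]
      exact gPow_eq_of_dvd P ⟨-1, by ring⟩)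
    (by
      rw [← MulOpposite.op_mul, ← MulOpposite.op_mul, ← MulOpposite.op_smul]
      congr 1
      rw [mul_neg, neg_mul, smul_neg, mul_assoc (x P), ← gPow_add, add_comm, gPow_add,
        ← mul_assoc (x P), x_mul_gPow P (-1), smul_mul_assoc, smul_smul, mul_assoc]
      simp [mul_inv_cancel₀ (ξ_ne_zero P)])

/-- The antipode `S`. -/
def antipodeMap : TaftAlgebra P →ₗ[k] TaftAlgebra P :=
  (MulOpposite.opLinearEquiv k).symm.toLinearMap ∘ₗ (antipodeHom P).toLinearMap

theorem antipodeMap_mul (a b : TaftAlgebra P) :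
    antipodeMap P (a * b) = antipodeMap P b * antipodeMap P a := by
  simp [antipodeMap]

theorem antipodeMap_one : antipodeMap P 1 = 1 := by
  simp [antipodeMap]

theorem antipodeMap_g : antipodeMap P (g P) = gPow P (-1) := by
  simp [antipodeMap, antipodeHom]

theorem antipodeMap_x : antipodeMap P (x P) = -(x P * gPow P (-P.t)) := by
  simp [antipodeMap, antipodeHom]

theorem antipodeMap_g_pow (m : ℕ) : antipodeMap P (g P ^ m) = gPow P (-m) := by
  induction m with
  | zero => simp [antipodeMap_one, gPow_zero]
  | succ m ih =>
    rw [pow_succ, antipodeMap_mul, antipodeMap_g, ih, ← gPow_add]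
    congr 1; push_cast; ring

instance : HopfAlgebra k (TaftAlgebra P) where
  antipode := antipodeMap P
  mul_antipode_rTensor_comul := by
    ext a
    simp only [LinearMap.comp_apply]
    induction a using induction with
    | hc c =>
      simp [Algebra.algebraMap_eq_smul_one, Algebra.TensorProduct.one_def, antipodeMap_one]
    | hg =>
      rw [comul_g]
      simp only [LinearMap.rTensor_tmul, LinearMap.mul'_apply,
        antipodeMap_g, counit_g]
      rw [← gPow_one, ← gPow_add]
      simp [gPow_zero]
    | hx =>
      have h : gPow P (-P.t) * g P ^ P.t = 1 := by
        rw [← gPow_natCast, ← gPow_add, neg_add_cancel, gPow_zero]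
      simp [comul_x, counit_x, antipodeMap_x, antipodeMap_one, mul_assoc, h]
    | hadd a b ha hb => simp only [map_add, ha, hb]
    | hmul a b ha hb =>
      have key : ∀ z w : TaftAlgebra P ⊗[k] TaftAlgebra P,
          LinearMap.mul' k _ ((antipodeMap P).rTensor _ z) ∈ (⊥ : Subalgebra k (TaftAlgebra P)) →
          LinearMap.mul' k _ ((antipodeMap P).rTensor _ (z * w)) =
            LinearMap.mul' k _ ((antipodeMap P).rTensor _ z) *
              LinearMap.mul' k _ ((antipodeMap P).rTensor _ w) := by
        intro z w hz
        obtain ⟨c, hc⟩ := Algebra.mem_bot.1 hz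
        induction w using TensorProduct.induction_on with
        | zero => simp
        | add u v hu hv => simp only [mul_add, map_add, hu, hv]
        | tmul p q =>
          have : ∀ z : TaftAlgebra P ⊗[k] TaftAlgebra P,
              LinearMap.mul' k _ ((antipodeMap P).rTensor _ (z * p ⊗ₜ[k] q)) =
              antipodeMap P p * LinearMap.mul' k _ ((antipodeMap P).rTensor _ z) * q := by
            intro z
            induction z using TensorProduct.induction_on with
            | zero => simp
            | add u v hu hv => simp only [add_mul, mul_add, map_add, hu, hv]
            | tmul u v => simp [antipodeMap_mul, mul_assoc]
          rw [this, ← hc, ← Algebra.commutes, mul_assoc]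
          simp
      rw [Bialgebra.comul_mul, key _ _ (by rw [ha]; exact Subalgebra.algebraMap_mem _ _), ha, hb]
      simp
  mul_antipode_lTensor_comul := by
    ext a
    simp only [LinearMap.comp_apply]
    induction a using induction with
    | hc c =>
      simp [Algebra.algebraMap_eq_smul_one, Algebra.TensorProduct.one_def, antipodeMap_one]
    | hg =>
      rw [comul_g]
      simp only [LinearMap.lTensor_tmul, LinearMap.mul'_apply,
        antipodeMap_g, counit_g]
      rw [← gPow_one, ← gPow_add]
      simp [gPow_zero]
    | hx =>
      simp [comul_x, counit_x, antipodeMap_x, antipodeMap_g_pow]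
    | hadd a b ha hb => simp only [map_add, ha, hb]
    | hmul a b ha hb =>
      have key : ∀ z w : TaftAlgebra P ⊗[k] TaftAlgebra P,
          LinearMap.mul' k _ ((antipodeMap P).lTensor _ w) ∈ (⊥ : Subalgebra k (TaftAlgebra P)) →
          LinearMap.mul' k _ ((antipodeMap P).lTensor _ (z * w)) =
            LinearMap.mul' k _ ((antipodeMap P).lTensor _ z) *
              LinearMap.mul' k _ ((antipodeMap P).lTensor _ w) := by
        intro z w hz
        obtain ⟨c, hc⟩ := Algebra.mem_bot.1 hz
        induction z using TensorProduct.induction_on with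
        | zero => simp
        | add u v hu hv => simp only [add_mul, map_add, hu, hv]
        | tmul p q =>
          have : ∀ w : TaftAlgebra P ⊗[k] TaftAlgebra P,
              LinearMap.mul' k _ ((antipodeMap P).lTensor _ (p ⊗ₜ[k] q * w)) =
              p * LinearMap.mul' k _ ((antipodeMap P).lTensor _ w) * antipodeMap P q := by
            intro z
            induction z using TensorProduct.induction_on with
            | zero => simp
            | add u v hu hv => simp only [add_mul, mul_add, map_add, hu, hv]
            | tmul u v => simp [antipodeMap_mul, mul_assoc]
          rw [this, ← hc, mul_assoc, Algebra.commutes, ← mul_assoc]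
          simp
      rw [Bialgebra.comul_mul, key _ _ (by rw [hb]; exact Subalgebra.algebraMap_mem _ _), ha, hb]
      simp

theorem antipode_eq : (HopfAlgebra.antipode k : TaftAlgebra P →ₗ[k] TaftAlgebra P) =
    antipodeMap P := rfl

/-- The elements `c_j^i(k, l)` of `H(n, t, ξ)`, extended by `0` to `l > k`: `c_j^i(0, 0) = g ^ i`
and `c_j^i(k + 1, l) = c_j^i(k, l) S(x) + ξ ^ (t (j - l)) x c_j^i(k, l) S(g ^ t)
+ c_j^i(k, l - 1) S(g ^ t)` for `l ≤ k + 1`, where the last summand is absent for `l = 0` (and the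
first two summands vanish for `l = k + 1`). -/
def comatrixEntry (i j : ℤ) : ℕ → ℕ → TaftAlgebra P
  | 0, 0 => gPow P i
  | 0, _ + 1 => 0
  | m + 1, 0 => comatrixEntry i j m 0 * HopfAlgebra.antipode k (x P) +
      P.ξ ^ (P.t * j) • (x P * comatrixEntry i j m 0 * HopfAlgebra.antipode k (g P ^ P.t))
  | m + 1, l + 1 => comatrixEntry i j m (l + 1) * HopfAlgebra.antipode k (x P) +
      P.ξ ^ (P.t * (j - (l + 1))) •
        (x P * comatrixEntry i j m (l + 1) * HopfAlgebra.antipode k (g P ^ P.t)) +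
      comatrixEntry i j m l * HopfAlgebra.antipode k (g P ^ P.t)

theorem comatrixEntry_of_lt (i j : ℤ) {m l : ℕ} (h : m < l) : comatrixEntry P i j m l = 0 := by
  induction m generalizing l with
  | zero =>
    obtain ⟨l, rfl⟩ : ∃ l', l = l' + 1 := ⟨l - 1, by omega⟩
    rfl
  | succ m ih =>
    obtain ⟨l, rfl⟩ : ∃ l', l = l' + 1 := ⟨l - 1, by omega⟩
    simp [comatrixEntry, ih (show m < l + 1 by omega), ih (show m < l by omega)]

/-- Gaussian binomial coefficients at `q`. -/
def gaussBinom (q : k) : ℕ → ℕ → k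
  | _, 0 => 1
  | 0, _ + 1 => 0
  | m + 1, l + 1 => q ^ (l + 1) * gaussBinom q m (l + 1) + gaussBinom q m l

theorem gaussBinom_of_lt (q : k) {m l : ℕ} (h : m < l) : gaussBinom q m l = 0 := by
  induction m generalizing l with
  | zero =>
    obtain ⟨l, rfl⟩ : ∃ l', l = l' + 1 := ⟨l - 1, by omega⟩
    rfl
  | succ m ih =>
    obtain ⟨l, rfl⟩ : ∃ l', l = l' + 1 := ⟨l - 1, by omega⟩
    simp [gaussBinom, ih (show m < l + 1 by omega), ih (show m < l by omega)]

theorem gaussBinom_succ' (q : k) (m l : ℕ) (h : l ≤ m) :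
    gaussBinom q (m + 1) (l + 1) = gaussBinom q m (l + 1) + q ^ (m - l) * gaussBinom q m l := by
  induction m generalizing l with
  | zero =>
    obtain rfl : l = 0 := by omega
    simp [gaussBinom]
  | succ m ih =>
    rcases Nat.eq_zero_or_pos l with rfl | hl
    · have h1 : gaussBinom q (m + 1 + 1) (0 + 1) = q ^ 1 * gaussBinom q (m + 1) 1 + 1 := by
        simp [gaussBinom]
      have h2 : gaussBinom q (m + 1) (0 + 1) = q ^ 1 * gaussBinom q m 1 + 1 := by
        simp [gaussBinom]
      have h3 := ih 0 (Nat.zero_le _)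
      have h0 : gaussBinom q (m + 1) 0 = 1 := by simp [gaussBinom]
      have h0' : gaussBinom q m 0 = 1 := by simp [gaussBinom]
      simp only [zero_add, Nat.sub_zero, h0'] at *
      rw [h1, h0]
      linear_combination q * h3 - h2
    · obtain ⟨l, rfl⟩ : ∃ l', l = l' + 1 := ⟨l - 1, by omega⟩
      have h1 : gaussBinom q (m + 1 + 1) (l + 1 + 1) =
        q ^ (l + 1 + 1) * gaussBinom q (m + 1) (l + 1 + 1) + gaussBinom q (m + 1) (l + 1) := rfl
      have h2 : gaussBinom q (m + 1) (l + 1 + 1) =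
        q ^ (l + 1 + 1) * gaussBinom q m (l + 1 + 1) + gaussBinom q m (l + 1) := rfl
      have h4 : gaussBinom q (m + 1) (l + 1) =
        q ^ (l + 1) * gaussBinom q m (l + 1) + gaussBinom q m l := rfl
      have h5 := ih l (by omega)
      rcases Nat.lt_or_ge l m with hlt | hge
      · have h3 := ih (l + 1) (by omega)
        obtain ⟨e, rfl⟩ : ∃ e, m = l + 1 + e := ⟨m - (l + 1), by omega⟩
        rw [show l + 1 + e - (l + 1) = e by omega] at h3
        rw [show l + 1 + e - l = e + 1 by omega] at h5
        rw [show l + 1 + e + 1 - (l + 1) = e + 1 by omega]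
        rw [h1]
        linear_combination q ^ (l + 2) * h3 + h5 - h2 - q ^ (e + 1) * h4
      · obtain rfl : l = m := by omega
        rw [h1, gaussBinom_of_lt q (show l + 1 < l + 1 + 1 by omega)]
        simp

/-- `(1 - q^l) [m, l] = (1 - q^m) [m-1, l-1]`. -/
theorem gaussBinom_absorb (q : k) (m l : ℕ) (h : l ≤ m) :
    (1 - q ^ (l + 1)) * gaussBinom q (m + 1) (l + 1) =
      (1 - q ^ (m + 1)) * gaussBinom q m l := by
  have h1 : gaussBinom q (m + 1) (l + 1) =
      q ^ (l + 1) * gaussBinom q m (l + 1) + gaussBinom q m l := rfl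
  have h2 := gaussBinom_succ' q m l h
  obtain ⟨e, rfl⟩ : ∃ e, m = l + e := ⟨m - l, by omega⟩
  rw [show l + e - l = e by omega] at h2
  rw [show q ^ (l + e + 1) = q ^ (l + 1) * q ^ e by ring]
  linear_combination h1 - q ^ (l + 1) * h2

/-- `c_j^{ti}(m, l)` is an explicit multiple of `x ^ (m - l) g ^ (t (i - m))`. -/
theorem comatrixEntry_eq (i j : ℤ) (m l : ℕ) (h : l ≤ m) :
    comatrixEntry P (P.t * i) j m l =
      (gaussBinom ((P.ξ ^ P.t)⁻¹) m l *
        ∏ s ∈ Finset.Ico l m, ((P.ξ ^ P.t) ^ j - (P.ξ ^ P.t) ^ ((s : ℤ) - i))) •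
      (x P ^ (m - l) * gPow P (P.t * (i - m))) := by
  have hξ := ξ_ne_zero P
  have hw : P.ξ ^ P.t ≠ 0 := pow_ne_zero _ hξ
  have hS : ∀ (e : ℕ) (m : ℕ), x P ^ e * gPow P (P.t * (i - m)) * HopfAlgebra.antipode k (x P) =
      -((P.ξ ^ P.t) ^ ((m : ℤ) - i) • (x P ^ (e + 1) * gPow P (P.t * (i - (m + 1))))) := by
    intro e m
    have h1 : gPow P (P.t * (i - m)) * x P =
        (P.ξ ^ P.t) ^ ((m : ℤ) - i) • (x P * gPow P (P.t * (i - m))) := by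
      rw [x_mul_gPow, smul_smul, ← zpow_natCast, ← zpow_mul, ← zpow_add₀ hξ]
      rw [show (P.t : ℤ) * (m - i) + P.t * (i - m) = 0 by ring]
      simp
    rw [antipode_eq, antipodeMap_x, mul_neg, ← mul_assoc, mul_assoc _ _ (x P), h1,
      mul_smul_comm, smul_mul_assoc, ← mul_assoc, ← pow_succ, mul_assoc, ← gPow_add]
    congr 5; ring
  have hG : ∀ (e : ℕ) (m : ℕ),
      x P ^ e * gPow P (P.t * (i - m)) * HopfAlgebra.antipode k (g P ^ P.t) =
      x P ^ e * gPow P (P.t * (i - (m + 1))) := by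
    intro e m
    rw [antipode_eq, antipodeMap_g_pow, mul_assoc, ← gPow_add]
    congr 2; ring
  have hz : ∀ a : ℤ, P.ξ ^ (P.t * a) = (P.ξ ^ P.t) ^ a := fun a => by
    rw [← zpow_natCast, ← zpow_mul]
  induction m generalizing l with
  | zero =>
    obtain rfl : l = 0 := by omega
    simp [comatrixEntry, gaussBinom]
  | succ m ih =>
    rcases Nat.eq_zero_or_pos l with rfl | hl
    · rw [comatrixEntry, ih 0 (Nat.zero_le _), smul_mul_assoc, hS, mul_smul_comm, smul_mul_assoc,
        ← mul_assoc, Nat.sub_zero, ← pow_succ', hG, Nat.sub_zero, hz,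
        Finset.prod_Ico_succ_top (Nat.zero_le _)]
      rw [smul_neg, smul_smul, smul_smul, ← neg_smul, ← add_smul]
      push_cast
      congr 1
      simp only [gaussBinom]
      ring
    · obtain ⟨l, rfl⟩ : ∃ l', l = l' + 1 := ⟨l - 1, by omega⟩
      rw [comatrixEntry, ih l (by omega)]
      rcases Nat.lt_or_ge l m with hlt | hge
      · rw [ih (l + 1) (by omega), smul_mul_assoc, hS, mul_smul_comm, smul_mul_assoc,
        ← mul_assoc, ← pow_succ', hG, hz, smul_mul_assoc, hG,
        show m - (l + 1) + 1 = m - l by omega, show m + 1 - (l + 1) = m - l by omega]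
        rw [smul_neg, smul_smul, smul_smul, ← neg_smul, ← add_smul, ← add_smul]
        push_cast
        congr 1
        rw [Finset.prod_Ico_succ_top (show l + 1 ≤ m by omega),
          Finset.prod_eq_prod_Ico_succ_bot (show l < m from hlt)]
        have e1 : gaussBinom ((P.ξ ^ P.t)⁻¹) (m + 1) (l + 1) = ((P.ξ ^ P.t)⁻¹) ^ (l + 1) *
          gaussBinom ((P.ξ ^ P.t)⁻¹) m (l + 1) + gaussBinom ((P.ξ ^ P.t)⁻¹) m l := rfl
        have e2 := gaussBinom_succ' ((P.ξ ^ P.t)⁻¹) m l (by omega)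
        generalize gaussBinom ((P.ξ ^ P.t)⁻¹) (m + 1) (l + 1) = B at *
        generalize gaussBinom ((P.ξ ^ P.t)⁻¹) m (l + 1) = B1 at *
        generalize gaussBinom ((P.ξ ^ P.t)⁻¹) m l = B0 at *
        generalize ∏ s ∈ Finset.Ico (l + 1) m,
          ((P.ξ ^ P.t) ^ j - (P.ξ ^ P.t) ^ ((s : ℤ) - i)) = Pr
        generalize P.ξ ^ P.t = w at *
        have f1 : w ^ (j - ((l : ℤ) + 1)) = w ^ j * (w⁻¹) ^ (l + 1) := by
          rw [zpow_sub₀ hw, div_eq_mul_inv, inv_pow]; norm_cast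
        have f2 : w ^ ((m : ℤ) - i) * w⁻¹ ^ (m - l) = w ^ ((l : ℤ) - i) := by
          rw [inv_pow, ← zpow_natCast, ← zpow_neg, ← zpow_add₀ hw]
          congr 1; push_cast [hlt.le]; ring
        rw [f1]
        linear_combination (-Pr) * (w ^ j * e1 - w ^ ((m : ℤ) - i) * e2) + Pr * B0 * f2
      · obtain rfl : l = m := by omega
        rw [comatrixEntry_of_lt P _ _ (show l < l + 1 by omega), smul_mul_assoc, hG]
        have e1 : gaussBinom ((P.ξ ^ P.t)⁻¹) (l + 1) (l + 1) = ((P.ξ ^ P.t)⁻¹) ^ (l + 1) *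
          gaussBinom ((P.ξ ^ P.t)⁻¹) l (l + 1) + gaussBinom ((P.ξ ^ P.t)⁻¹) l l := rfl
        rw [e1, gaussBinom_of_lt _ (show l < l + 1 by omega)]
        simp

theorem comatrixEntry_n (i j : ℤ) {l : ℕ} (h : l < P.n) :
    comatrixEntry P (P.t * i) j P.n l = 0 := by
  rw [comatrixEntry_eq P i j _ _ h.le]
  have hw : P.ξ ^ P.t ≠ 0 := pow_ne_zero _ (ξ_ne_zero P)
  have hwn : (P.ξ ^ P.t) ^ P.n = 1 := by
    rw [← pow_mul, mul_comm, pow_mul, P.isPrimitiveRoot.pow_eq_one, one_pow]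
  generalize P.ξ ^ P.t = w at *
  by_cases hl : w ^ l = 1
  · -- a factor of the product vanishes
    have hd : w ^ (P.n - l) = 1 := by
      have : w ^ (P.n - l) * w ^ l = 1 := by rw [← pow_add, Nat.sub_add_cancel h.le, hwn]
      rwa [hl, mul_one] at this
    have hpos : (0 : ℤ) < ((P.n - l : ℕ) : ℤ) := by exact_mod_cast Nat.sub_pos_of_lt h
    have hr0 := Int.emod_nonneg (i + j - l) hpos.ne'
    have hr1 := Int.emod_lt_of_pos (i + j - l) hpos
    have hr2 := Int.emod_add_mul_ediv (i + j - l) ((P.n - l : ℕ) : ℤ)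
    obtain ⟨r, hr⟩ := Int.eq_ofNat_of_zero_le hr0
    rw [hr] at hr1 hr2
    rw [Finset.prod_eq_zero (i := l + r) (by rw [Finset.mem_Ico]; omega), mul_zero, zero_smul]
    rw [sub_eq_zero]
    have : j = ((l + r : ℕ) : ℤ) - i + ((P.n - l : ℕ) : ℤ) *
        ((i + j - l) / ((P.n - l : ℕ) : ℤ)) := by push_cast; linarith
    conv_lhs => rw [this, zpow_add₀ hw, zpow_mul, zpow_natCast, hd, one_zpow, mul_one]
  · obtain ⟨m, hm⟩ : ∃ m, P.n = m + 1 := ⟨P.n - 1, by omega⟩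
    obtain ⟨l, rfl⟩ : ∃ l', l = l' + 1 := ⟨l - 1, by
      rcases l with _ | l
      · simp at hl
      · omega⟩
    have := gaussBinom_absorb w⁻¹ m l (by omega)
    rw [← hm, inv_pow, inv_pow, hwn, inv_one, sub_self, zero_mul, mul_eq_zero] at this
    rcases this with h0 | h0
    · exact absurd (by rw [sub_eq_zero] at h0; exact inv_eq_one.mp h0.symm) hl
    · simp [h0]

theorem comatrixEntry_diag (i j : ℤ) (m : ℕ) :
    comatrixEntry P (P.t * i) j m m = gPow P (P.t * (i - m)) := by
  induction m with
  | zero => simp [comatrixEntry]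
  | succ m ih =>
    rw [comatrixEntry, ih, comatrixEntry_of_lt P _ _ (Nat.lt_succ_self m), antipode_eq,
      antipodeMap_g_pow, ← gPow_add]
    simp only [zero_mul, mul_zero, smul_zero, zero_add]
    congr 1; push_cast; ring
end TaftAlgebra

open TaftAlgebra

/-- The underlying vector space of `V(ti, j, c)`: it has the basis `v_0, …, v_{n-1}`. This is the
module denoted `V(ti, j, c)` when `c ≠ 0`. -/
@[nolint unusedArguments]
def TaftModule (_i _j : ℤ) (_c : k) : Type _ := Fin P.n → k

namespace TaftModule

variable (i j : ℤ) (c : k)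

instance : AddCommGroup (TaftModule P i j c) := inferInstanceAs (AddCommGroup (Fin P.n → k))

instance : Module k (TaftModule P i j c) := inferInstanceAs (Module k (Fin P.n → k))

/-- The basis `v_0, …, v_{n-1}`. -/
def basis : Module.Basis (Fin P.n) k (TaftModule P i j c) := Pi.basisFun k (Fin P.n)

/-- The operator `g · v_p = ξ ^ (j - p) v_p`. -/
def gOperator : Module.End k (TaftModule P i j c) :=
  (basis P i j c).constr k fun p => P.ξ ^ (j - p) • basis P i j c p

/-- The operator `x · v_p = v_{p+1}` for `p < n - 1` and `x · v_{n-1} = c v_0`. -/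
def xOperator : Module.End k (TaftModule P i j c) :=
  (basis P i j c).constr k fun p =>
    if h : (p : ℕ) + 1 < P.n then basis P i j c ⟨p + 1, h⟩ else c • basis P i j c 0

theorem gOperator_basis (p : Fin P.n) :
    gOperator P i j c (basis P i j c p) = P.ξ ^ (j - p) • basis P i j c p := by
  simp [gOperator]

theorem xOperator_basis (p : Fin P.n) : xOperator P i j c (basis P i j c p) =
    if h : (p : ℕ) + 1 < P.n then basis P i j c ⟨p + 1, h⟩ else c • basis P i j c 0 := by
  rw [xOperator, Module.Basis.constr_basis]

theorem ξ_zpow_n_mul (e : ℤ) : P.ξ ^ (P.n * e) = 1 := by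
  rw [zpow_mul, zpow_natCast, P.isPrimitiveRoot.pow_eq_one, one_zpow]

theorem gOperator_pow : gOperator P i j c ^ P.n = 1 := by
  refine (basis P i j c).ext fun p => ?_
  have h : ∀ m : ℕ, (gOperator P i j c ^ m) (basis P i j c p) =
      P.ξ ^ (m * (j - p)) • basis P i j c p := by
    intro m
    induction m with
    | zero => simp
    | succ m ih =>
      rw [pow_succ', Module.End.mul_apply, ih, map_smul, gOperator_basis, smul_smul,
        ← zpow_add₀ (ξ_ne_zero P)]
      congr 2; push_cast; ring
  rw [h, ξ_zpow_n_mul]; simp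

theorem xOperator_mul_gOperator : xOperator P i j c * gOperator P i j c =
    P.ξ • (gOperator P i j c * xOperator P i j c) := by
  refine (basis P i j c).ext fun p => ?_
  rw [Module.End.mul_apply, LinearMap.smul_apply, Module.End.mul_apply, gOperator_basis, map_smul,
    xOperator_basis]
  have hξ := ξ_ne_zero P
  split_ifs with h
  · rw [gOperator_basis, smul_smul, ← zpow_one_add₀ hξ]
    congr 2; push_cast; ring
  · have hp : (p : ℕ) + 1 = P.n := by omega
    rw [map_smul, gOperator_basis, smul_comm c, smul_smul P.ξ, ← zpow_one_add₀ hξ]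
    congr 1
    rw [show 1 + (j - ((0 : Fin P.n) : ℕ)) = (j - (p : ℕ)) + P.n * 1 by
      have hp' : ((p : ℕ) : ℤ) + 1 = P.n := by exact_mod_cast hp
      rw [← hp']; simp; ring]
    rw [zpow_add₀ hξ, ξ_zpow_n_mul, mul_one]

/-- The representation of `H(n, t, ξ)` on `V(ti, j, c)`. -/
def representation : TaftAlgebra P →ₐ[k] Module.End k (TaftModule P i j c) :=
  TaftAlgebra.lift P (gOperator P i j c) (xOperator P i j c) (gOperator_pow P i j c)
    (xOperator_mul_gOperator P i j c)

instance : Module (TaftAlgebra P) (TaftModule P i j c) :=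
  Module.compHom _ (representation P i j c).toRingHom

theorem smul_def (h : TaftAlgebra P) (v : TaftModule P i j c) :
    h • v = representation P i j c h v := rfl

instance : IsScalarTower k (TaftAlgebra P) (TaftModule P i j c) where
  smul_assoc a h v := by rw [smul_def, smul_def, map_smul, LinearMap.smul_apply]

theorem g_smul (v : TaftModule P i j c) : g P • v = gOperator P i j c v := by
  rw [smul_def, representation, lift_g]

theorem x_smul (v : TaftModule P i j c) : x P • v = xOperator P i j c v := by
  rw [smul_def, representation, lift_x]

/-- The coaction `δ(v_p) = ∑_{l ≤ p} c_j^{ti}(p, l) ⊗ v_l`. -/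
def coactionMap : TaftModule P i j c →ₗ[k] TaftAlgebra P ⊗[k] TaftModule P i j c :=
  (basis P i j c).constr k fun p =>
    ∑ l ∈ Finset.Iic p, comatrixEntry P (P.t * i) j p l ⊗ₜ[k] basis P i j c l

/-- The vectors `u_m = x ^ m · v_0`. -/
def orbit (m : ℕ) : TaftModule P i j c :=
  c ^ (m / P.n) • basis P i j c ⟨m % P.n, Nat.mod_lt _ (NeZero.pos _)⟩

theorem orbit_of_lt {m : ℕ} (h : m < P.n) : orbit P i j c m = basis P i j c ⟨m, h⟩ := by
  simp [orbit, Nat.div_eq_of_lt h, Nat.mod_eq_of_lt h]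

theorem orbit_coe (p : Fin P.n) : orbit P i j c p = basis P i j c p := orbit_of_lt P i j c p.2

theorem x_smul_orbit (m : ℕ) : x P • orbit P i j c m = orbit P i j c (m + 1) := by
  rw [x_smul, orbit, map_smul, xOperator_basis, orbit]
  have hn := NeZero.pos P.n
  have h1 := Nat.mod_lt m hn
  have h2 := Nat.div_add_mod m P.n
  split_ifs with h
  · have hd : (m + 1) / P.n = m / P.n := by
      simp only at h
      exact Nat.div_eq_of_lt_le (by rw [mul_comm]; omega) (by rw [mul_comm, mul_add]; omega)
    have hm : (m + 1) % P.n = m % P.n + 1 := by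
      have h3 := Nat.div_add_mod (m + 1) P.n
      rw [hd] at h3; omega
    simp only [hd, hm]
  · have he : m % P.n + 1 = P.n := by simp only at h; omega
    have h4 : m + 1 = P.n * (m / P.n + 1) := by rw [mul_add, mul_one]; omega
    have hd : (m + 1) / P.n = m / P.n + 1 := by
      rw [h4, Nat.mul_div_cancel_left _ hn]
    have hm : (m + 1) % P.n = 0 := by rw [h4, Nat.mul_mod_right]
    simp only [hd, hm]
    rw [pow_succ, mul_smul]; rfl

theorem g_smul_orbit (m : ℕ) : g P • orbit P i j c m = P.ξ ^ (j - m) • orbit P i j c m := by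
  rw [g_smul, orbit, map_smul, gOperator_basis, smul_comm]
  congr 1
  have h : (m : ℤ) = (m % P.n : ℕ) + P.n * (m / P.n : ℕ) := by
    have := Nat.mod_add_div m P.n; exact_mod_cast this.symm
  rw [h, ← sub_sub, sub_eq_add_neg _ ((P.n : ℤ) * _), ← mul_neg, zpow_add₀ (ξ_ne_zero P),
    ξ_zpow_n_mul, mul_one]

theorem g_pow_smul_orbit (e m : ℕ) :
    g P ^ e • orbit P i j c m = P.ξ ^ (e * (j - m)) • orbit P i j c m := by
  induction e with
  | zero => simp
  | succ e ih =>
    rw [pow_succ', mul_smul, ih, smul_comm, g_smul_orbit, smul_smul, ← zpow_add₀ (ξ_ne_zero P)]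
    congr 2; push_cast; ring

theorem coactionMap_orbit {m : ℕ} (h : m < P.n) : coactionMap P i j c (orbit P i j c m) =
    ∑ l ∈ Finset.range (m + 1), comatrixEntry P (P.t * i) j m l ⊗ₜ[k] orbit P i j c l := by
  rw [orbit_of_lt P i j c h, coactionMap, Module.Basis.constr_basis]
  refine Finset.sum_bij (fun l _ => (l : ℕ)) ?_ ?_ ?_ ?_
  · intro l hl
    have : (l : ℕ) ≤ m := Fin.le_def.1 (Finset.mem_Iic.1 hl)
    rw [Finset.mem_range]; omega
  · intro a _ b _ hab
    exact Fin.ext hab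
  · intro b hb
    have := Finset.mem_range.1 hb
    exact ⟨⟨b, by omega⟩, Finset.mem_Iic.2 (by change b ≤ m; omega), rfl⟩
  · intro l _
    rw [orbit_coe]

theorem ydOperator_g_tmul (a : TaftAlgebra P) (v : TaftModule P i j c) :
    ydOperator k (TaftAlgebra P) (TaftModule P i j c) (g P) (a ⊗ₜ v) =
      (g P * a * gPow P (-1)) ⊗ₜ (g P • v) := by
  simp [ydOperator, comul_g, antipode_eq, antipodeMap_g, mul_assoc]

theorem ydOperator_g_pow_tmul (e : ℕ) (a : TaftAlgebra P) (v : TaftModule P i j c) :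
    ydOperator k (TaftAlgebra P) (TaftModule P i j c) (g P ^ e) (a ⊗ₜ v) =
      (g P ^ e * a * gPow P (-e)) ⊗ₜ (g P ^ e • v) := by
  have hc : Coalgebra.comul (R := k) (g P ^ e) = (g P ^ e) ⊗ₜ[k] (g P ^ e) := by
    rw [Bialgebra.comul_pow, comul_g, Algebra.TensorProduct.tmul_pow]
  simp [ydOperator, hc, antipode_eq, antipodeMap_g_pow, mul_assoc, -map_pow]

theorem ydOperator_x_tmul (a : TaftAlgebra P) (v : TaftModule P i j c) :
    ydOperator k (TaftAlgebra P) (TaftModule P i j c) (x P) (a ⊗ₜ v) =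
      (a * HopfAlgebra.antipode k (x P)) ⊗ₜ v +
      (a * HopfAlgebra.antipode k (g P ^ P.t)) ⊗ₜ (x P • v) +
      (x P * a * HopfAlgebra.antipode k (g P ^ P.t)) ⊗ₜ (g P ^ P.t • v) := by
  have hc : Coalgebra.comul (R := k) (g P ^ P.t) = (g P ^ P.t) ⊗ₜ[k] (g P ^ P.t) := by
    rw [Bialgebra.comul_pow, comul_g, Algebra.TensorProduct.tmul_pow]
  simp [ydOperator, comul_x, hc, mul_assoc, -map_pow]
  abel

theorem ydOperator_x_sum (m : ℕ) :
    ydOperator k (TaftAlgebra P) (TaftModule P i j c) (x P)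
      (∑ l ∈ Finset.range (m + 1), comatrixEntry P (P.t * i) j m l ⊗ₜ[k] orbit P i j c l) =
    ∑ l ∈ Finset.range (m + 2), comatrixEntry P (P.t * i) j (m + 1) l ⊗ₜ[k] orbit P i j c l := by
  rw [map_sum]
  simp only [ydOperator_x_tmul, x_smul_orbit, g_pow_smul_orbit, TensorProduct.tmul_smul,
    TensorProduct.smul_tmul']
  rw [Finset.sum_add_distrib, Finset.sum_add_distrib]
  set A : ℕ → TaftAlgebra P ⊗[k] TaftModule P i j c := fun l =>
    (comatrixEntry P (P.t * i) j m l * HopfAlgebra.antipode k (x P)) ⊗ₜ[k] orbit P i j c l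
  set B : ℕ → TaftAlgebra P ⊗[k] TaftModule P i j c := fun l =>
    (P.ξ ^ ((P.t : ℤ) * (j - l)) • (x P * comatrixEntry P (P.t * i) j m l *
      HopfAlgebra.antipode k (g P ^ P.t))) ⊗ₜ[k] orbit P i j c l
  set C : ℕ → TaftAlgebra P ⊗[k] TaftModule P i j c := fun l =>
    (comatrixEntry P (P.t * i) j m l * HopfAlgebra.antipode k (g P ^ P.t)) ⊗ₜ[k]
      orbit P i j c (l + 1)
  have h0 : comatrixEntry P (P.t * i) j (m + 1) 0 ⊗ₜ[k] orbit P i j c 0 = A 0 + B 0 := by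
    simp [A, B, comatrixEntry, TensorProduct.add_tmul]
  have h1 : ∀ l, comatrixEntry P (P.t * i) j (m + 1) (l + 1) ⊗ₜ[k] orbit P i j c (l + 1) =
      A (l + 1) + B (l + 1) + C l := by
    intro l
    simp [A, B, C, comatrixEntry, TensorProduct.add_tmul]
  have hA : A (m + 1) = 0 := by
    simp [A, comatrixEntry_of_lt P _ _ (Nat.lt_succ_self m)]
  have hB : B (m + 1) = 0 := by
    simp [B, comatrixEntry_of_lt P _ _ (Nat.lt_succ_self m)]
  rw [Finset.sum_range_succ' _ (m + 1), h0]
  simp only [h1, Finset.sum_add_distrib]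
  have eA : ∑ l ∈ Finset.range (m + 1), A (l + 1) + A 0 = ∑ l ∈ Finset.range (m + 1), A l := by
    rw [← Finset.sum_range_succ' A, Finset.sum_range_succ, hA, add_zero]
  have eB : ∑ l ∈ Finset.range (m + 1), B (l + 1) + B 0 = ∑ l ∈ Finset.range (m + 1), B l := by
    rw [← Finset.sum_range_succ' B, Finset.sum_range_succ, hB, add_zero]
  rw [← eA, ← eB]
  abel

theorem coactionMap_x (v : TaftModule P i j c) : coactionMap P i j c (x P • v) =
    ydOperator k (TaftAlgebra P) (TaftModule P i j c) (x P) (coactionMap P i j c v) := by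
  have key : coactionMap P i j c ∘ₗ xOperator P i j c =
      ydOperator k (TaftAlgebra P) (TaftModule P i j c) (x P) ∘ₗ coactionMap P i j c := by
    refine (basis P i j c).ext fun p => ?_
    rw [LinearMap.comp_apply, LinearMap.comp_apply, ← x_smul, ← orbit_coe, x_smul_orbit,
      coactionMap_orbit P i j c p.2, ydOperator_x_sum]
    rcases Nat.lt_or_ge ((p : ℕ) + 1) P.n with h | h
    · rw [coactionMap_orbit P i j c h]
    · have hp : (p : ℕ) + 1 = P.n := by omega
      have hn : orbit P i j c P.n = c • orbit P i j c 0 := by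
        simp [orbit, Nat.div_self (NeZero.pos P.n)]
      rw [show (p : ℕ) + 2 = P.n + 1 by omega, hp, Finset.sum_range_succ,
        Finset.sum_eq_zero, zero_add, comatrixEntry_diag, hn, map_smul,
        coactionMap_orbit P i j c (NeZero.pos P.n)]
      · rw [zero_add, Finset.sum_range_one, TensorProduct.tmul_smul]
        congr 2
        rw [comatrixEntry]
        exact gPow_eq_of_dvd P ⟨P.t, by ring⟩
      · intro l hl
        rw [comatrixEntry_n P i j (Finset.mem_range.1 hl), TensorProduct.zero_tmul]
  rw [x_smul]
  exact LinearMap.congr_fun key v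

theorem coactionMap_g (v : TaftModule P i j c) : coactionMap P i j c (g P • v) =
    ydOperator k (TaftAlgebra P) (TaftModule P i j c) (g P) (coactionMap P i j c v) := by
  have key : coactionMap P i j c ∘ₗ gOperator P i j c =
      ydOperator k (TaftAlgebra P) (TaftModule P i j c) (g P) ∘ₗ coactionMap P i j c := by
    refine (basis P i j c).ext fun p => ?_
    rw [LinearMap.comp_apply, LinearMap.comp_apply, ← g_smul, ← orbit_coe, g_smul_orbit,
      map_smul, coactionMap_orbit P i j c p.2, map_sum, Finset.smul_sum]
    refine Finset.sum_congr rfl fun l hl => ?_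
    have hl' : l ≤ (p : ℕ) := by have := Finset.mem_range.1 hl; omega
    rw [ydOperator_g_tmul, g_smul_orbit, TensorProduct.tmul_smul, TensorProduct.smul_tmul',
      TensorProduct.smul_tmul']
    congr 1
    have hx : ∀ e : ℕ, g P * x P ^ e = P.ξ ^ (-(e : ℤ)) • (x P ^ e * g P) := by
      have hξ := ξ_ne_zero P
      have h4 : g P * x P = P.ξ⁻¹ • (x P * g P) := by
        rw [x_mul_g, smul_smul, inv_mul_cancel₀ hξ, one_smul]
      intro e
      induction e with
      | zero => simp
      | succ e ih =>
        rw [pow_succ, ← mul_assoc, ih, smul_mul_assoc, mul_assoc, h4, mul_smul_comm, smul_smul,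
          ← mul_assoc, ← zpow_sub_one₀ hξ]
        congr 2; push_cast; ring
    rw [comatrixEntry_eq P i j _ _ hl']
    generalize (gaussBinom ((P.ξ ^ P.t)⁻¹) p l *
        ∏ s ∈ Finset.Ico l (p : ℕ), ((P.ξ ^ P.t) ^ j - (P.ξ ^ P.t) ^ ((s : ℤ) - i))) = C
    rw [mul_smul_comm, smul_mul_assoc, ← mul_assoc, hx, smul_mul_assoc, smul_mul_assoc,
      mul_assoc (_ * g P), mul_assoc (x P ^ _), ← gPow_one, ← gPow_add, ← gPow_add, smul_comm C,
      smul_smul (P.ξ ^ (j - (l : ℤ))), ← zpow_add₀ (ξ_ne_zero P)]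
    rw [show 1 + ((P.t : ℤ) * (i - (p : ℕ)) + -1) = P.t * (i - (p : ℕ)) by ring]
    congr 2; push_cast [hl']; ring
  rw [g_smul]
  exact LinearMap.congr_fun key v

theorem coactionMap_smul (h : TaftAlgebra P) (v : TaftModule P i j c) :
    coactionMap P i j c (h • v) =
      ydOperator k (TaftAlgebra P) (TaftModule P i j c) h (coactionMap P i j c v) := by
  induction h using TaftAlgebra.induction generalizing v with
  | hc a => rw [algebraMap_smul, map_smul, ydOperator_algebraMap]
  | hg => exact coactionMap_g P i j c v
  | hx => exact coactionMap_x P i j c v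
  | hmul a b ha hb => rw [mul_smul, ha, hb, ydOperator_mul, Module.End.mul_apply]
  | hadd a b ha hb => rw [add_smul, map_add, ha, hb, map_add, LinearMap.add_apply]

theorem exists_gPow_eq_pow (e : ℤ) : ∃ m : ℕ, gPow P e = g P ^ m := by
  have hn : (P.n : ℤ) ≠ 0 := by exact_mod_cast NeZero.ne P.n
  obtain ⟨m, hm⟩ := Int.eq_ofNat_of_zero_le (Int.emod_nonneg e hn)
  refine ⟨m, ?_⟩
  rw [← gPow_natCast]
  refine gPow_eq_of_dvd P ⟨e / P.n, ?_⟩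
  have := Int.emod_add_mul_ediv e P.n
  rw [hm] at this
  change (m : ℤ) + _ = e at this
  linarith

theorem comul_gPow (e : ℤ) : Coalgebra.comul (R := k) (gPow P e) = gPow P e ⊗ₜ[k] gPow P e := by
  obtain ⟨m, hm⟩ := exists_gPow_eq_pow P e
  rw [hm, Bialgebra.comul_pow, comul_g, Algebra.TensorProduct.tmul_pow]

theorem counit_gPow (e : ℤ) : Coalgebra.counit (R := k) (gPow P e) = 1 := by
  obtain ⟨m, hm⟩ := exists_gPow_eq_pow P e
  rw [hm, Bialgebra.counit_pow, counit_g, one_pow]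

theorem comul_antipode_g_pow (e : ℕ) :
    Coalgebra.comul (R := k) (HopfAlgebra.antipode k (g P ^ e)) =
      HopfAlgebra.antipode k (g P ^ e) ⊗ₜ[k] HopfAlgebra.antipode k (g P ^ e) := by
  rw [antipode_eq, antipodeMap_g_pow, comul_gPow]

theorem comul_antipode_x : Coalgebra.comul (R := k) (HopfAlgebra.antipode k (x P)) =
    HopfAlgebra.antipode k (x P) ⊗ₜ[k] 1 +
      HopfAlgebra.antipode k (g P ^ P.t) ⊗ₜ[k] HopfAlgebra.antipode k (x P) := by
  have h : g P ^ P.t * gPow P (-P.t) = 1 := by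
    rw [← gPow_natCast, ← gPow_add, add_neg_cancel, gPow_zero]
  rw [antipode_eq, antipodeMap_x, antipodeMap_g_pow, map_neg, Bialgebra.comul_mul, comul_x,
    comul_gPow, add_mul, Algebra.TensorProduct.tmul_mul_tmul,
    Algebra.TensorProduct.tmul_mul_tmul, h, one_mul, TensorProduct.neg_tmul,
    TensorProduct.tmul_neg, neg_add]

theorem coactionMap_coassoc :
    (TensorProduct.assoc k (TaftAlgebra P) (TaftAlgebra P) (TaftModule P i j c)).toLinearMap ∘ₗ
      (Coalgebra.comul : TaftAlgebra P →ₗ[k] _).rTensor (TaftModule P i j c) ∘ₗ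
        coactionMap P i j c =
    (coactionMap P i j c).lTensor (TaftAlgebra P) ∘ₗ coactionMap P i j c := by
  let L : TaftAlgebra P ⊗[k] TaftModule P i j c →ₗ[k]
      TaftAlgebra P ⊗[k] (TaftAlgebra P ⊗[k] TaftModule P i j c) :=
    (TensorProduct.assoc k (TaftAlgebra P) (TaftAlgebra P) (TaftModule P i j c)).toLinearMap ∘ₗ
      (Coalgebra.comul : TaftAlgebra P →ₗ[k] _).rTensor (TaftModule P i j c)
  let ρ := ydOperator k (TaftAlgebra P) (TaftModule P i j c)
  let r : TaftAlgebra P → TaftAlgebra P →ₗ[k] TaftAlgebra P := LinearMap.mulRight k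
  let Θ : TaftAlgebra P ⊗[k] (TaftAlgebra P ⊗[k] TaftModule P i j c) →ₗ[k]
      TaftAlgebra P ⊗[k] (TaftAlgebra P ⊗[k] TaftModule P i j c) :=
    TensorProduct.map (r (HopfAlgebra.antipode k (x P))) LinearMap.id +
    TensorProduct.map (r (HopfAlgebra.antipode k (g P ^ P.t))) (ρ (x P)) +
    TensorProduct.map (LinearMap.mulLeft k (x P) ∘ₗ r (HopfAlgebra.antipode k (g P ^ P.t)))
      (ρ (g P ^ P.t))
  have hL : ∀ z, L (ρ (x P) z) = Θ (L z) := by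
    intro z
    induction z using TensorProduct.induction_on with
    | zero => simp
    | add u v hu hv => simp only [map_add, hu, hv]
    | tmul a v =>
      have e1 : ∀ (b : TaftAlgebra P) (w : TaftModule P i j c), L (b ⊗ₜ w) =
          TensorProduct.assoc k _ _ _ (Coalgebra.comul (R := k) b ⊗ₜ w) := fun _ _ => rfl
      simp only [ρ, ydOperator_x_tmul, map_add, e1, Bialgebra.comul_mul, comul_antipode_x,
        comul_antipode_g_pow, comul_x]
      generalize Coalgebra.comul (R := k) a = y
      induction y using TensorProduct.induction_on with
      | zero => simp
      | add u v hu hv =>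
        simp only [add_mul, mul_add, TensorProduct.add_tmul, map_add] at hu hv ⊢
        rw [← hu, ← hv]
        abel
      | tmul p q =>
        simp only [Θ, r, ρ, LinearMap.add_apply, mul_add, add_mul,
          Algebra.TensorProduct.tmul_mul_tmul, TensorProduct.add_tmul, map_add,
          TensorProduct.assoc_tmul, TensorProduct.map_tmul, LinearMap.mulRight_apply,
          LinearMap.mulLeft_apply, LinearMap.comp_apply, LinearMap.id_apply, mul_one, one_mul,
          ydOperator_x_tmul, ydOperator_g_pow_tmul, TensorProduct.tmul_add]
        simp only [antipode_eq, antipodeMap_g_pow, mul_assoc]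
        abel
  have hR : ∀ z, (coactionMap P i j c).lTensor (TaftAlgebra P) (ρ (x P) z) =
      Θ ((coactionMap P i j c).lTensor (TaftAlgebra P) z) := by
    intro z
    induction z using TensorProduct.induction_on with
    | zero => simp
    | add u v hu hv => simp only [map_add, hu, hv]
    | tmul a v =>
      simp only [ρ, ydOperator_x_tmul, map_add, LinearMap.lTensor_tmul, coactionMap_smul, Θ, r,
        LinearMap.add_apply, TensorProduct.map_tmul, LinearMap.mulRight_apply,
        LinearMap.mulLeft_apply, LinearMap.comp_apply, LinearMap.id_apply, mul_assoc]
  have key : ∀ m : ℕ, L (coactionMap P i j c (orbit P i j c m)) =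
      (coactionMap P i j c).lTensor (TaftAlgebra P) (coactionMap P i j c (orbit P i j c m)) := by
    intro m
    induction m with
    | zero =>
      have e0 : coactionMap P i j c (orbit P i j c 0) =
          gPow P (P.t * i) ⊗ₜ[k] orbit P i j c 0 := by
        rw [coactionMap_orbit P i j c (NeZero.pos P.n), zero_add, Finset.sum_range_one,
          comatrixEntry]
      rw [e0, LinearMap.lTensor_tmul, e0]
      simp only [L, LinearMap.comp_apply, LinearMap.rTensor_tmul, comul_gPow,
        LinearEquiv.coe_coe, TensorProduct.assoc_tmul]
    | succ m ih =>
      rw [← x_smul_orbit, coactionMap_x, hL, hR, ih]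
  refine (basis P i j c).ext fun p => ?_
  rw [← orbit_coe]
  exact key p

theorem coactionMap_counit :
    (TensorProduct.lid k (TaftModule P i j c)).toLinearMap ∘ₗ
      (Coalgebra.counit : TaftAlgebra P →ₗ[k] k).rTensor (TaftModule P i j c) ∘ₗ
        coactionMap P i j c = LinearMap.id := by
  let L : TaftAlgebra P ⊗[k] TaftModule P i j c →ₗ[k] TaftModule P i j c :=
    (TensorProduct.lid k (TaftModule P i j c)).toLinearMap ∘ₗ
      (Coalgebra.counit : TaftAlgebra P →ₗ[k] k).rTensor (TaftModule P i j c)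
  have hL : ∀ z, L (ydOperator k (TaftAlgebra P) (TaftModule P i j c) (x P) z) = x P • L z := by
    intro z
    induction z using TensorProduct.induction_on with
    | zero => simp
    | add u v hu hv => simp only [map_add, smul_add, hu, hv]
    | tmul a v =>
      rw [ydOperator_x_tmul]
      simp [L, antipode_eq, antipodeMap_x, antipodeMap_g_pow, counit_x, counit_gPow,
        smul_comm (x P)]
  have key : ∀ m : ℕ, L (coactionMap P i j c (orbit P i j c m)) = orbit P i j c m := by
    intro m
    induction m with
    | zero =>
      rw [coactionMap_orbit P i j c (NeZero.pos P.n), zero_add, Finset.sum_range_one,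
        comatrixEntry]
      simp [L, counit_gPow]
    | succ m ih =>
      rw [← x_smul_orbit, coactionMap_x, hL, ih]
  refine (basis P i j c).ext fun p => ?_
  rw [← orbit_coe]
  exact key p

instance : YetterDrinfeldModule k (TaftAlgebra P) (TaftModule P i j c) where
  coaction := coactionMap P i j c
  coassoc := coactionMap_coassoc P i j c
  counit := coactionMap_counit P i j c
  compat := coactionMap_smul P i j c

end TaftModule

end Taft

end

/-! Write `W` for the span of `v_0, …, v_p` with `p ≡ i` mod `n`, and `φ` for the `p`-th coordinate
form. The coaction is triangular, so `W` is a subcomodule, and the diagonal coefficient `c(p, p) = g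
^ (t (i - p))` is `1` because `g ^ n = 1`. Thus `v_p` is coinvariant modulo the span of the earlier
basis vectors; equivalently, `φ` restricts to a comodule map from `W` to the trivial comodule. Seen
through `φ`, the braiding of `v_p` with itself is the flip, and the powers of `v_p` behave as in a
polynomial ring in one variable: contracting `Δ_{1^m}(v_p^m)` with `φ ⊗ ⋯ ⊗ φ` gives `m!`, which is
nonzero in characteristic `0`.

To avoid expanding `Δ_{1^m}`, its contraction is written as an iterate of the skew derivation `∂_φ =
(φ π₁ ⊗ id) Δ` (`powForm_deltaOnes`). The braided Leibniz rule `skewDerivation_ι_mul` reads `∂_f(v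
y) = f(v) y + v₍₀₎ ∂_{f(v₍₋₁₎ ·)}(y)`. Let `χ` be the character of `T(V)` extending `φ`. For `v ∈ W`
one has `φ(v₍₀₎) v₍₋₁₎ = φ(v) 1`, so after applying `χ` the twist of the form disappears and `χ ∂_φ
= d χ` on `W^{⊗d}`, an Euler identity (`lift_skewDerivation`). Iterating it produces the factorial
(`deltaOnesCoeff_eq_factorial`).

The same functionals prove infinite dimension. Each one lives in a single degree and factors there
through `Δ_{1^m}`, so it descends to the Nichols algebra (`nicholsKernel_le_ker_deltaOnesCoeff`),
and the powers of `v_p` stay linearly independent in the quotient. -/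

noncomputable section

/-! ### The projection `π₁` of the tensor algebra to degree one. -/

namespace TensorAlgebra

variable {k V : Type*} [Field k] [AddCommGroup V] [Module k V]

theorem ιInv_algebraMap (r : k) : ιInv (algebraMap k (TensorAlgebra k V) r) = 0 := by
  simp only [ιInv, LinearMap.comp_apply, AlgHom.toLinearMap_apply, AlgHom.commutes]
  exact TrivSqZeroExt.snd_inl V r

/-- The projection `π₁` is the nilpotent component of an algebra map to the trivial square-zero
extension `k ⊕ V`, whose scalar component is the augmentation `ε`. Hence it is a derivation with
respect to `ε`. -/
theorem ιInv_mul (a b : TensorAlgebra k V) :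
    ιInv (a * b) = algebraMapInv a • ιInv b + algebraMapInv b • ιInv a := by
  -- The right `k`-action has to be the one used in the definition of `ιInv`.
  let _ : Module kᵐᵒᵖ V := Module.compHom _ ((RingHom.id k).fromOpposite mul_comm)
  have _ : IsCentralScalar k V := ⟨fun r m => rfl⟩
  have h : ∀ a : TensorAlgebra k V, (toTrivSqZeroExt a).fst = algebraMapInv a := by
    intro a
    have : (TrivSqZeroExt.fstHom k k V).comp (toTrivSqZeroExt (R := k) (M := V)) =
        algebraMapInv := by
      ext v
      simp [algebraMapInv]
    exact congrArg (fun F : TensorAlgebra k V →ₐ[k] k => F a) this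
  simp [ιInv, h]

end TensorAlgebra

/-! ### Compatibility of `ε` and `π₁` with the action of `H`. -/

section SkewDerivation

variable {k H V : Type*} [Field k] [Ring H] [HopfAlgebra k H]
  [AddCommGroup V] [Module k V] [Module H V] [IsScalarTower k H V]

local notation "T" => TensorAlgebra k V

namespace YetterDrinfeldModule

open TensorAlgebra

theorem algebraMapInv_tensorSMul (h : H) (a : T) :
    algebraMapInv (tensorSMul k H V h a) = Coalgebra.counit (R := k) h * algebraMapInv a := by
  induction a using TensorAlgebra.induction generalizing h with
  | algebraMap r => simp [Algebra.algebraMap_eq_smul_one, tensorSMul_one, mul_comm]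
  | ι v => simp [tensorSMul_ι, algebraMapInv]
  | add a b ha hb => simp [ha, hb, mul_add]
  | mul a b ha hb =>
    -- Stated for any tensor in place of the coproduct of `h`, so that pure tensors suffice; the
    -- counit axiom is used only afterwards. The next proofs follow the same pattern.
    have key : ∀ z : H ⊗[k] H, algebraMapInv (LinearMap.mul' k T (TensorProduct.map
        ((tensorSMul k H V).flip a) ((tensorSMul k H V).flip b) z)) =
        Coalgebra.counit (R := k) (TensorProduct.lid k H
          ((Coalgebra.counit (R := k) (A := H)).rTensor H z)) * algebraMapInv (a * b) := by
      intro z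
      induction z using TensorProduct.induction_on with
      | zero => simp
      | add x y hx hy => simp only [map_add, hx, hy, add_mul]
      | tmul p q => simp [ha, hb]; ring
    rw [tensorSMul_mul, key, Coalgebra.rTensor_counit_comul]
    simp

/-- In each summand of the derivation rule for `π₁` one factor sits under `ε`, where `H` acts
through its counit. The two counit axioms, one per summand, then restore `h`. -/
theorem ιInv_tensorSMul (h : H) (a : T) :
    ιInv (tensorSMul k H V h a) = h • ιInv a := by
  induction a using TensorAlgebra.induction generalizing h with
  | algebraMap r =>
    rw [ιInv_algebraMap, Algebra.algebraMap_eq_smul_one, map_smul, map_smul, tensorSMul_one,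
      ιInv_algebraMap, smul_zero, smul_zero]
  | ι v => rw [tensorSMul_ι, ι_leftInverse, ι_leftInverse]
  | add a b ha hb => simp [ha, hb]
  | mul a b ha hb =>
    have key : ∀ z : H ⊗[k] H, ιInv (LinearMap.mul' k T (TensorProduct.map
        ((tensorSMul k H V).flip a) ((tensorSMul k H V).flip b) z)) =
        algebraMapInv a • (TensorProduct.lid k H
          ((Coalgebra.counit (R := k) (A := H)).rTensor H z)) • ιInv b +
        algebraMapInv b • (TensorProduct.rid k H
          ((Coalgebra.counit (R := k) (A := H)).lTensor H z)) • ιInv a := by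
      intro z
      induction z using TensorProduct.induction_on with
      | zero => simp
      | add x y hx hy =>
        simp only [map_add, hx, hy, add_smul, smul_add]
        abel
      | tmul p q =>
        simp only [TensorProduct.map_tmul, LinearMap.mul'_apply, LinearMap.flip_apply, ιInv_mul,
          algebraMapInv_tensorSMul, ha, hb, LinearMap.rTensor_tmul, LinearMap.lTensor_tmul,
          TensorProduct.lid_tmul, TensorProduct.rid_tmul, smul_assoc]
        rw [mul_comm, mul_smul, mul_comm (Coalgebra.counit (R := k) q), mul_smul]
    rw [tensorSMul_mul, key, Coalgebra.rTensor_counit_comul, Coalgebra.lTensor_counit_comul,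
      ιInv_mul, smul_add, smul_comm h (algebraMapInv a), smul_comm h (algebraMapInv b)]
    simp

/-! ### The braided comultiplication and its skew derivations. -/

variable [YetterDrinfeldModule k H V]

theorem tensorCoaction_ι (v : V) : tensorCoaction k H V (ι k v) =
    (ι k).lTensor H (coaction (k := k) (H := H) v) := by
  simp [tensorCoaction]

variable (H) in
theorem braidedComul_one : braidedComul k H V 1 = 1 ⊗ₜ[k] 1 := by
  simp only [braidedComul, LinearMap.comp_apply, AlgHom.toLinearMap_apply, map_one]
  rfl

theorem braidedComul_mul (a b : T) : braidedComul k H V (a * b) =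
    braidedMul k H V (braidedComul k H V a ⊗ₜ[k] braidedComul k H V b) := by
  simp only [braidedComul, LinearMap.comp_apply, AlgHom.toLinearMap_apply, map_mul]
  rfl

theorem braidedComul_ι (v : V) : braidedComul k H V (ι k v) =
    ι k v ⊗ₜ[k] 1 + 1 ⊗ₜ[k] ι k v := by
  simp [braidedComul, braidedComulAlgHom]

variable (H) in
-- The map `ε ⊗ id` is multiplicative for the braided product, since `ε` is `H`-linear and the
-- coaction is counital. So `(ε ⊗ id) Δ` is multiplicative and need only be checked on generators.
theorem braidedComul_counit (a : T) : TensorProduct.lid k T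
    ((algebraMapInv (R := k) (M := V)).toLinearMap.rTensor T (braidedComul k H V a)) = a := by
  let C : T ⊗[k] T →ₗ[k] T := (TensorProduct.lid k T).toLinearMap ∘ₗ
    (algebraMapInv (R := k) (M := V)).toLinearMap.rTensor T
  have hC : ∀ z w : T ⊗[k] T, C (braidedMul k H V (z ⊗ₜ[k] w)) = C z * C w := by
    intro z w
    induction z using TensorProduct.induction_on with
    | zero => simp
    | add x y hx hy => simp only [map_add, TensorProduct.add_tmul, hx, hy, add_mul]
    | tmul a b =>
      induction w using TensorProduct.induction_on with
      | zero => simp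
      | add x y hx hy => simp only [map_add, TensorProduct.tmul_add, hx, hy, mul_add]
      | tmul a' b' =>
        -- Here `z` stands for the coaction of `b`; applying `ε` to the acted-on factor leaves the
        -- counit of its first leg.
        have key : ∀ z : H ⊗[k] T, C (TensorProduct.map
            (LinearMap.mulLeft k a ∘ₗ (tensorSMul k H V).flip a') (LinearMap.mulRight k b') z) =
            algebraMapInv a • algebraMapInv a' • (TensorProduct.lid k T
              ((Coalgebra.counit (R := k) (A := H)).rTensor T z) * b') := by
          intro z
          induction z using TensorProduct.induction_on with
          | zero => simp
          | add x y hx hy => simp only [map_add, hx, hy, add_mul, smul_add]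
          | tmul p q =>
            simp [C, algebraMapInv_tensorSMul, smul_smul, mul_comm]
        rw [braidedMul_tmul, key, tensorCoaction_counit]
        simp only [C, LinearMap.comp_apply, LinearMap.rTensor_tmul, LinearEquiv.coe_coe,
          TensorProduct.lid_tmul, AlgHom.toLinearMap_apply, smul_mul_smul_comm, smul_smul]
  change C (braidedComul k H V a) = a
  induction a using TensorAlgebra.induction with
  | algebraMap r => simp [Algebra.algebraMap_eq_smul_one, braidedComul_one, C]
  | ι v => simp [braidedComul_ι, C, algebraMapInv]
  | add a b ha hb => rw [map_add, map_add, ha, hb]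
  | mul a b ha hb => rw [braidedComul_mul, hC, ha, hb]

variable (k H V) in
/-- The operator `∂_f = (f π₁ ⊗ id) Δ` on `T(V)` associated with a linear form `f` on `V`. -/
def skewDerivation : Module.Dual k V →ₗ[k] T →ₗ[k] T where
  toFun f := (TensorProduct.lid k T).toLinearMap ∘ₗ (f ∘ₗ ιInv).rTensor T ∘ₗ braidedComul k H V
  map_add' f g := by
    rw [LinearMap.add_comp, LinearMap.rTensor_add, LinearMap.add_comp, LinearMap.comp_add]
  map_smul' r f := by
    rw [LinearMap.smul_comp, LinearMap.rTensor_smul, LinearMap.smul_comp, LinearMap.comp_smul]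
    rfl

theorem skewDerivation_apply (f : Module.Dual k V) (y : T) : skewDerivation k H V f y =
    TensorProduct.lid k T ((f ∘ₗ ιInv).rTensor T (braidedComul k H V y)) := rfl

theorem skewDerivation_algebraMap (f : Module.Dual k V) (r : k) :
    skewDerivation k H V f (algebraMap k T r) = 0 := by
  have h : ιInv (1 : T) = 0 := by rw [← map_one (algebraMap k T), ιInv_algebraMap]
  simp [skewDerivation_apply, Algebra.algebraMap_eq_smul_one, braidedComul_one, h]

/-- The linear form `v ↦ f (h • v)`. -/
def dualSMul (h : H) (f : Module.Dual k V) : Module.Dual k V := f ∘ₗ Algebra.lsmul k k V h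

/-- The braided Leibniz rule, from `Δ(v y) = (v ⊗ 1 + 1 ⊗ v) Δ(y)`. Since `π₁(v a) = ε(a) v`, the
first summand gives `f(v) (ε ⊗ id) Δ(y) = f(v) y`. In the second, `v₍₋₁₎` acts on the left leg of
`Δ(y)`, and `H`-linearity of `π₁` moves that action to `f`. The presentation `S` of the coaction is
left free so that it can later be taken inside a subcomodule. -/
theorem skewDerivation_ι_mul (f : Module.Dual k V) (v : V) (y : T) (S : Finset (H × V))
    (hS : coaction (k := k) v = ∑ s ∈ S, s.1 ⊗ₜ[k] s.2) :
    skewDerivation k H V f (ι k v * y) =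
      f v • y + ∑ s ∈ S, ι k s.2 * skewDerivation k H V (dualSMul s.1 f) y := by
  have key : ∀ z : T ⊗[k] T, TensorProduct.lid k T ((f ∘ₗ ιInv).rTensor T
      (braidedMul k H V ((ι k v ⊗ₜ[k] 1 + 1 ⊗ₜ[k] ι k v) ⊗ₜ[k] z))) =
      f v • TensorProduct.lid k T
        ((algebraMapInv (R := k) (M := V)).toLinearMap.rTensor T z) +
      ∑ s ∈ S, ι k s.2 * TensorProduct.lid k T ((dualSMul s.1 f ∘ₗ ιInv).rTensor T z) := by
    intro z
    induction z using TensorProduct.induction_on with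
    | zero => simp
    | add x y hx hy =>
      simp only [map_add, TensorProduct.tmul_add, hx, hy, smul_add, mul_add,
        Finset.sum_add_distrib]
      abel
    | tmul a b =>
      -- This removes the other term, `ε(v) π₁(a)`, of `π₁(v a)`.
      have h0 : algebraMapInv (ι k v) = 0 := by simp [algebraMapInv]
      rw [TensorProduct.add_tmul, map_add, map_add, map_add, braidedMul_tmul, braidedMul_tmul,
        tensorCoaction_ι, hS, map_one, Algebra.TensorProduct.one_def]
      simp only [TensorProduct.map_tmul, map_sum, LinearMap.comp_apply, LinearMap.flip_apply,
        LinearMap.mulLeft_apply, LinearMap.mulRight_apply, LinearMap.rTensor_tmul,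
        LinearMap.lTensor_tmul, TensorProduct.lid_tmul, one_tensorSMul, ιInv_mul, h0,
        ι_leftInverse v, one_mul, ιInv_tensorSMul, dualSMul, zero_smul, zero_add, map_smul,
        smul_eq_mul, AlgHom.toLinearMap_apply, Algebra.lsmul_coe, mul_smul_comm]
      rw [mul_comm, mul_smul]
  rw [skewDerivation_apply, braidedComul_mul, braidedComul_ι, key, braidedComul_counit]
  rfl

/-! ### Subcomodules and the behaviour of skew derivations on them. -/

/-- `W` is a subcomodule of `V`. -/
def IsSubcomodule (H : Type*) [Ring H] [HopfAlgebra k H] [Module H V] [IsScalarTower k H V]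
    [YetterDrinfeldModule k H V] (W : Submodule k V) : Prop :=
  W ≤ (LinearMap.range (W.subtype.lTensor H)).comap (coaction (k := k))

variable (k H V) in
theorem isSubcomodule_top : IsSubcomodule H (⊤ : Submodule k V) := fun _ _ =>
  LinearMap.lTensor_surjective H (fun w => ⟨⟨w, trivial⟩, rfl⟩) _

theorem IsSubcomodule.exists_finset {W : Submodule k V} (hW : IsSubcomodule H W) (v : V)
    (hv : v ∈ W) : ∃ S : Finset (H × V), (∀ s ∈ S, s.2 ∈ W) ∧
      coaction (k := k) v = ∑ s ∈ S, s.1 ⊗ₜ[k] s.2 := by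
  obtain ⟨z, hz⟩ := hW hv
  obtain ⟨S, rfl⟩ := TensorProduct.exists_finset z
  -- Injectivity of the inclusion keeps distinct terms distinct, so the sum over the image set is
  -- unchanged.
  refine ⟨S.map ⟨Prod.map id Subtype.val, Function.injective_id.prodMap Subtype.val_injective⟩,
    ?_, ?_⟩
  · intro s hs
    obtain ⟨u, -, rfl⟩ := Finset.mem_map.1 hs
    exact u.2.2
  · rw [← hz, map_sum, Finset.sum_map]
    rfl

variable {W : Submodule k V}

/-- In the Leibniz rule the vectors `v₍₀₎` can be chosen in `W`, while the form changes to `f(v₍₋₁₎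
·)`. The induction therefore runs over all forms `f` at once. -/
theorem skewDerivation_mem_pow (hW : IsSubcomodule H W) (d : ℕ) (f : Module.Dual k V) (y : T)
    (hy : y ∈ W.map (ι k) ^ (d + 1)) : skewDerivation k H V f y ∈ W.map (ι k) ^ d := by
  induction d generalizing f y with
  | zero =>
    rw [zero_add, pow_one] at hy
    obtain ⟨v, hv, rfl⟩ := hy
    obtain ⟨S, -, hS⟩ := hW.exists_finset v hv
    -- Degree one is the Leibniz rule for `v · 1`, where every twisted term vanishes.
    rw [← mul_one (ι k v), skewDerivation_ι_mul f v 1 S hS, ← map_one (algebraMap k T)]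
    simp only [skewDerivation_algebraMap, mul_zero, Finset.sum_const_zero, add_zero, pow_zero]
    exact Submodule.smul_mem _ _ (by rw [map_one]; exact Submodule.one_le.1 le_rfl)
  | succ d ih =>
    rw [pow_succ'] at hy
    induction hy using Submodule.mul_induction_on' with
    | add a _ b _ ha hb => rw [map_add]; exact add_mem ha hb
    | mem_mul_mem a ha y hy =>
      obtain ⟨v, hv, rfl⟩ := ha
      obtain ⟨S, hSW, hS⟩ := hW.exists_finset v hv
      rw [skewDerivation_ι_mul f v y S hS]
      refine add_mem (Submodule.smul_mem _ _ hy) (sum_mem fun s hs => ?_)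
      rw [pow_succ']
      exact Submodule.mul_mem_mul ⟨s.2, hSW s hs, rfl⟩ (ih _ y hy)

theorem skewDerivation_pow_zero (f : Module.Dual k V) (y : T)
    (hy : y ∈ W.map (ι k) ^ 0) : skewDerivation k H V f y = 0 := by
  rw [pow_zero, Submodule.mem_one] at hy
  obtain ⟨r, rfl⟩ := hy
  exact skewDerivation_algebraMap f r

/-- If the linear form `φ` restricts to a comodule map from `W` to the trivial comodule `k`, then
`∂_φ` followed by the character `χ` of `T(V)` extending `φ` is `d χ` on `W^{⊗d}`. -/
theorem lift_skewDerivation (hW : IsSubcomodule H W) (φ : Module.Dual k V)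
    (hφ : ∀ v ∈ W, TensorProduct.rid k H (φ.lTensor H (coaction v)) = φ v • 1)
    (d : ℕ) (y : T) (hy : y ∈ W.map (ι k) ^ d) :
    lift k φ (skewDerivation k H V φ y) = d * lift k φ y := by
  induction d generalizing y with
  | zero => rw [skewDerivation_pow_zero φ y hy]; simp
  | succ d ih =>
    rw [pow_succ'] at hy
    induction hy using Submodule.mul_induction_on' with
    | add a _ b _ ha hb => simp only [map_add, ha, hb, mul_add]
    | mem_mul_mem a ha y hy =>
      obtain ⟨v, hv, rfl⟩ := ha
      obtain ⟨S, hSW, hS⟩ := hW.exists_finset v hv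
      -- The comodule condition in coordinates: `φ(v₍₀₎) v₍₋₁₎ = φ(v) 1`.
      have h1 : ∑ s ∈ S, φ s.2 • s.1 = φ v • (1 : H) := by
        rw [← hφ v hv, hS]
        simp
      -- Acting with both sides of `h1` on a vector and applying `φ`: the twisted forms, weighted by
      -- `φ(v₍₀₎)`, add up to a multiple of `φ`.
      have h2 : ∑ s ∈ S, φ s.2 • dualSMul s.1 φ = φ v • φ := by
        ext u
        have h3 := congrArg (fun h : H => φ (h • u)) h1
        simp only [Finset.sum_smul, map_sum, smul_assoc, map_smul, one_smul] at h3
        simpa [dualSMul] using h3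
      -- Multiplicativity of the character pulls out `φ(v₍₀₎)`, and linearity of `∂_f` in `f` allows
      -- `h2` to be used. What remains is `φ(v) χ(y) + φ(v) d χ(y)`, that is `(d + 1) χ(v y)`.
      have h4 : ∑ s ∈ S, lift k φ (ι k s.2 * skewDerivation k H V (dualSMul s.1 φ) y) =
          φ v * lift k φ (skewDerivation k H V φ y) := by
        have := congrArg (fun f => lift k φ (skewDerivation k H V f y)) h2
        simpa using this
      rw [skewDerivation_ι_mul φ v y S hS, map_add, map_sum, h4, ih y hy]
      simp
      ring

/-! ### Iterated skew derivations as functionals on the tensor algebra. -/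

variable (H) in
/-- The functional `(φ π₁ ⊗ ⋯ ⊗ φ π₁) Δ^m` on `T(V)`. -/
def deltaOnesCoeff (φ : Module.Dual k V) : ℕ → Module.Dual k T
  | 0 => φ ∘ₗ ιInv
  | m + 1 => deltaOnesCoeff φ m ∘ₗ skewDerivation k H V φ

/-- Each application of `∂_φ` contributes the current degree as a factor under the character and
lowers that degree by one; in degree one, `φ π₁` is the character itself. -/
theorem deltaOnesCoeff_eq_factorial (hW : IsSubcomodule H W) (φ : Module.Dual k V)
    (hφ : ∀ v ∈ W, TensorProduct.rid k H (φ.lTensor H (coaction v)) = φ v • 1)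
    (m : ℕ) (y : T) (hy : y ∈ W.map (ι k) ^ (m + 1)) :
    deltaOnesCoeff H φ m y = (m + 1).factorial * lift k φ y := by
  induction m generalizing y with
  | zero =>
    rw [zero_add, pow_one] at hy
    obtain ⟨v, -, rfl⟩ := hy
    simp [deltaOnesCoeff, ι_leftInverse v]
  | succ m ih =>
    rw [deltaOnesCoeff, LinearMap.comp_apply, ih _ (skewDerivation_mem_pow hW _ _ _ hy),
      lift_skewDerivation hW φ hφ _ y hy, Nat.factorial_succ (m + 1)]
    push_cast
    ring

/-- The functional is `m` operators that lower the degree by one (and kill degree zero), followed by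
`φ π₁`, which sees only degree one. -/
theorem deltaOnesCoeff_eq_zero (φ : Module.Dual k V) (m d : ℕ) (h : d ≠ m + 1) (y : T)
    (hy : y ∈ LinearMap.range (ι k : V →ₗ[k] T) ^ d) : deltaOnesCoeff H φ m y = 0 := by
  rw [← Submodule.map_top] at hy
  induction m generalizing d y with
  | zero =>
    rcases d with _ | _ | d
    · rw [pow_zero, Submodule.mem_one] at hy
      obtain ⟨r, rfl⟩ := hy
      simp [deltaOnesCoeff, ιInv_algebraMap]
    · omega
    · rw [pow_succ', pow_succ'] at hy
      -- In degree at least two, splitting off one vector leaves a factor of positive degree. Both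
      -- factors are then killed by `ε`, hence the product by `π₁`.
      have hε : ∀ z ∈ (⊤ : Submodule k V).map (ι k) * (⊤ : Submodule k V).map (ι k) ^ d,
          algebraMapInv z = 0 := by
        intro z hz
        induction hz using Submodule.mul_induction_on' with
        | add a _ b _ ha hb => rw [map_add, ha, hb, add_zero]
        | mem_mul_mem a ha y hy =>
          obtain ⟨v, -, rfl⟩ := ha
          simp [algebraMapInv]
      induction hy using Submodule.mul_induction_on' with
      | add a _ b _ ha hb => rw [map_add, ha, hb, add_zero]
      | mem_mul_mem a ha y hy =>
        obtain ⟨v, -, rfl⟩ := ha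
        have h0 : algebraMapInv (ι k v) = 0 := by simp [algebraMapInv]
        simp [deltaOnesCoeff, ιInv_mul, h0, hε y hy]
  | succ m ih =>
    rcases d with _ | d
    · rw [deltaOnesCoeff, LinearMap.comp_apply, skewDerivation_pow_zero φ y hy, map_zero]
    · exact ih d (by omega) _ (skewDerivation_mem_pow (isSubcomodule_top k H V) d φ y hy)

/-! ### Comparison with `Δ_{1^m}` and descent to the Nichols algebra. -/

/-- The linear form `φ ⊗ ⋯ ⊗ φ`. -/
def _root_.PiTensorProduct.powForm (φ : Module.Dual k V) (m : ℕ) : Module.Dual k (⨂[k]^m V) :=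
  PiTensorProduct.lift
    ((MultilinearMap.mkPiAlgebra k (Fin m) k).compLinearMap fun _ => φ)

open PiTensorProduct in
theorem powForm_tprod (φ : Module.Dual k V) (m : ℕ) (v : Fin m → V) :
    powForm φ m (tprod k v) = ∏ s, φ (v s) := by
  simp [powForm]

open PiTensorProduct in
-- The recursion `Δ^{m+1} = (id ⊗ Δ^m) Δ` splits off the leftmost tensor factor, and `∂_φ` is
-- exactly `Δ` with that factor contracted by `φ π₁`.
theorem powForm_deltaOnes (φ : Module.Dual k V) (m : ℕ) (y : T) :
    powForm φ (m + 1) (deltaOnes k H V m y) = deltaOnesCoeff H φ m y := by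
  -- Absorbing `π₁` into the form leaves an induction about the iterated comultiplication alone.
  have hmap : ∀ (m : ℕ) (z : ⨂[k]^m T), powForm φ m (PiTensorProduct.map (fun _ => ιInv) z) =
      powForm (φ ∘ₗ ιInv) m z := by
    intro m z
    induction z using PiTensorProduct.induction_on with
    | smul_tprod r f => simp [powForm, map_tprod]
    | add a b ha hb => simp only [map_add, ha, hb]
  rw [deltaOnes, LinearMap.comp_apply, hmap]
  induction m generalizing y with
  | zero =>
    simp only [iteratedComul, deltaOnesCoeff, LinearEquiv.coe_coe]
    rw [PiTensorProduct.subsingletonEquiv_symm_apply', powForm_tprod]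
    simp
  | succ m ih =>
    have hcons : ∀ (a : T) (z : ⨂[k]^(m + 1) T), powForm (φ ∘ₗ ιInv) (m + 1 + 1)
        (tensorPowerCons k T (m + 1) (a ⊗ₜ[k] z)) =
        φ (ιInv a) * powForm (φ ∘ₗ ιInv) (m + 1) z := by
      intro a z
      induction z using PiTensorProduct.induction_on with
      | smul_tprod r f =>
        rw [TensorProduct.tmul_smul, map_smul, map_smul, map_smul, tensorPowerCons_tprod,
          powForm_tprod, powForm_tprod, Fin.prod_univ_succ]
        simp
        ring
      | add a b ha hb => simp only [TensorProduct.tmul_add, map_add, ha, hb, mul_add]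
    rw [deltaOnesCoeff, LinearMap.comp_apply, skewDerivation_apply, iteratedComul,
      LinearMap.comp_apply, LinearMap.comp_apply]
    generalize braidedComul k H V y = w
    induction w using TensorProduct.induction_on with
    | zero => simp
    | add x y hx hy => simp only [map_add, hx, hy]
    | tmul a b =>
      rw [LinearMap.lTensor_tmul, hcons, ih]
      simp

/-- The kernel is a sum of homogeneous pieces. On the piece of degree `m + 1` the functional factors
through `Δ_{1^{m+1}}`; the others vanish for reasons of degree. -/
theorem nicholsKernel_le_ker_deltaOnesCoeff (φ : Module.Dual k V) (m : ℕ) :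
    nicholsKernel k H V ≤ LinearMap.ker (deltaOnesCoeff H φ m) := by
  refine iSup_le fun d => iSup_le fun _ z hz => ?_
  obtain ⟨hz1, hz2⟩ := hz
  rw [LinearMap.mem_ker]
  by_cases h : d = m
  · subst h
    rw [← powForm_deltaOnes, LinearMap.mem_ker.1 hz2, map_zero]
  · exact deltaOnesCoeff_eq_zero φ m (d + 1) (by omega) z hz1

/-- If some `v` in a subcomodule `W` is not killed by a linear form that restricts to a comodule
map from `W` to the trivial comodule, then the Nichols algebra is infinite-dimensional. -/
theorem not_finiteDimensional_nicholsAlgebra [CharZero k] (hW : IsSubcomodule H W)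
    (φ : Module.Dual k V)
    (hφ : ∀ v ∈ W, TensorProduct.rid k H (φ.lTensor H (coaction v)) = φ v • 1)
    (v : V) (hv : v ∈ W) (hv0 : φ v ≠ 0) : ¬ FiniteDimensional k (NicholsAlgebra k H V) := by
  intro hfin
  -- The descended functionals are dual to these powers up to scalars: the `m`-th one sends `v ^ (d
  -- + 1)` to `0` for `d ≠ m` and to `(m + 1)! φ(v) ^ (m + 1) ≠ 0` for `d = m`. Exponents start at
  -- one because the functionals start in degree one.
  have hli : LinearIndependent k fun m : ℕ => (nicholsKernel k H V).mkQ (ι k v ^ (m + 1)) := by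
    rw [linearIndependent_iff']
    intro s a hs m hm
    have h := congrArg ((nicholsKernel k H V).liftQ (deltaOnesCoeff H φ m)
      (nicholsKernel_le_ker_deltaOnesCoeff φ m)) hs
    simp only [map_sum, map_smul, Submodule.mkQ_apply, Submodule.liftQ_apply, map_zero] at h
    rw [Finset.sum_eq_single_of_mem m hm] at h
    · rw [deltaOnesCoeff_eq_factorial hW φ hφ m _ (Submodule.pow_mem_pow _ (Submodule.mem_map_of_mem hv) _)] at h
      simpa [hv0, Nat.factorial_ne_zero] using h
    · intro d _ hd
      rw [deltaOnesCoeff_eq_zero φ m (d + 1) (by omega) _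
        (Submodule.pow_mem_pow _ (LinearMap.mem_range_self _ v) _), smul_zero]
  exact Infinite.not_finite (α := ℕ) hli.finite

end YetterDrinfeldModule

end SkewDerivation

/-! ### The subcomodule and the linear form for `V(ti, j, c)`. -/

namespace TaftModule

open TaftAlgebra YetterDrinfeldModule

variable {k : Type*} [Field k] (P : TaftParameters k) (i j : ℤ) (c : k)

theorem coaction_basis (p : Fin P.n) :
    coaction (k := k) (H := TaftAlgebra P) (basis P i j c p) =
      ∑ l ∈ Finset.Iic p, comatrixEntry P (P.t * i) j p l ⊗ₜ[k] basis P i j c l :=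
  (basis P i j c).constr_basis k _ p

/-- The span of `v_0, …, v_p`. -/
def initialSpan (p : Fin P.n) : Submodule k (TaftModule P i j c) :=
  Submodule.span k (basis P i j c '' Set.Iic p)

/-- Triangularity: the coaction of `v_q` involves only `v_l` with `l ≤ q`. -/
theorem isSubcomodule_initialSpan (p : Fin P.n) :
    IsSubcomodule (TaftAlgebra P) (initialSpan P i j c p) := by
  refine Submodule.span_le.2 ?_
  rintro _ ⟨q, hq, rfl⟩
  refine Submodule.mem_comap.2 ?_
  rw [coaction_basis]
  refine sum_mem fun l hl => ?_
  exact ⟨comatrixEntry P (P.t * i) j q l ⊗ₜ[k] ⟨basis P i j c l,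
    Submodule.subset_span ⟨l, (Finset.mem_Iic.1 hl).trans hq, rfl⟩⟩, rfl⟩

/-- This is where the choice of `p` enters. The form sees only the diagonal entry `g ^ (t (i - p))`
in the coaction of `v_p`, and the congruence makes it `1`. -/
theorem rid_coord_coaction (p : Fin P.n) (hp : (P.n : ℤ) ∣ p - i) (v : TaftModule P i j c)
    (hv : v ∈ initialSpan P i j c p) :
    TensorProduct.rid k (TaftAlgebra P) (((basis P i j c).coord p).lTensor (TaftAlgebra P)
      (coaction v)) = (basis P i j c).coord p v • 1 := by
  induction hv using Submodule.span_induction with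
  | zero => simp
  | add u v _ _ hu hv => simp only [map_add, hu, hv, add_smul]
  | smul r v _ hv => simp only [map_smul, hv, smul_assoc]
  | mem v hv =>
    obtain ⟨q, hq, rfl⟩ := hv
    rw [coaction_basis]
    simp only [map_sum, LinearMap.lTensor_tmul, TensorProduct.rid_tmul, Module.Basis.coord_apply,
      Module.Basis.repr_self]
    rcases eq_or_lt_of_le (Set.mem_Iic.1 hq) with rfl | hlt
    · rw [Finset.sum_eq_single_of_mem q (Finset.mem_Iic.2 le_rfl)]
      · rw [comatrixEntry_diag, gPow_eq_of_dvd P (b := 0), gPow_zero]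
        obtain ⟨e, he⟩ := hp
        exact ⟨-(P.t * e), by linear_combination (-(P.t : ℤ)) * he⟩
      · intro l _ hl
        rw [Finsupp.single_eq_of_ne hl.symm, zero_smul]
    -- For `q < p` all `v_l` in the coaction have `l ≤ q < p`, so both sides vanish.
    · rw [Finsupp.single_eq_of_ne hlt.ne', zero_smul]
      refine Finset.sum_eq_zero fun l hl => ?_
      rw [Finsupp.single_eq_of_ne ((Finset.mem_Iic.1 hl).trans_lt hlt).ne', zero_smul]

end TaftModule

end

/-! ### The main theorem. -/

theorem lemma5p7 {k : Type*} [Field k] [IsAlgClosed k] [CharZero k] (P : TaftParameters k)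
    (ht : 1 ≤ P.t) (i j : ℤ) (c : k) (hc : c ≠ 0) :
    ¬ FiniteDimensional k (NicholsAlgebra k (TaftAlgebra P) (TaftModule P i j c)) ∧
    ∀ p : Fin P.n, ((p : ℕ) : ℤ) = i → ∀ m : ℕ,
      (Basis.piTensorProduct fun _ : Fin (m + 1) => TaftModule.basis P i j c).repr
        (deltaOnes k (TaftAlgebra P) (TaftModule P i j c) m
          (TensorAlgebra.ι k (TaftModule.basis P i j c p) ^ (m + 1))) (fun _ => p) =
      ((m + 1).factorial : k) := by
  open YetterDrinfeldModule TaftModule in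
  have hmem : ∀ p : Fin P.n, basis P i j c p ∈ initialSpan P i j c p := fun p =>
    Submodule.subset_span ⟨p, Set.mem_Iic.2 le_rfl, rfl⟩
  have hcoord : ∀ p : Fin P.n, (basis P i j c).coord p (basis P i j c p) = 1 := fun p => by simp
  constructor
  · have hn : (0 : ℤ) < P.n := by exact_mod_cast NeZero.pos P.n
    have h0 := Int.emod_nonneg i hn.ne'
    have h1 := Int.emod_lt_of_pos i hn
    -- For an arbitrary integer `i`, its residue mod `n` is the index of the required basis vector.
    let p : Fin P.n := ⟨(i % P.n).toNat, by omega⟩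
    have hp : (P.n : ℤ) ∣ (p : ℕ) - i := by
      have : ((p : ℕ) : ℤ) = i % P.n := Int.toNat_of_nonneg h0
      rw [this]
      exact ⟨-(i / P.n), by have := Int.emod_add_mul_ediv i P.n; linarith⟩
    exact not_finiteDimensional_nicholsAlgebra (isSubcomodule_initialSpan P i j c p) _
      (rid_coord_coaction P i j c p hp) _ (hmem p) (by rw [hcoord]; exact one_ne_zero)
  · intro p hp m
    -- Extracting the coefficient of `v_p ⊗ ⋯ ⊗ v_p` is contraction with the `p`-th coordinate form
    -- in every factor.
    have hrepr : ∀ z, (Basis.piTensorProduct fun _ : Fin (m + 1) => basis P i j c).repr z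
        (fun _ => p) = PiTensorProduct.powForm ((basis P i j c).coord p) (m + 1) z := by
      intro z
      induction z using PiTensorProduct.induction_on with
      | smul_tprod r f =>
        rw [map_smul, map_smul, Finsupp.smul_apply, Basis.piTensorProduct_repr_tprod_apply,
          powForm_tprod]
        rfl
      | add a b ha hb => simp only [map_add, Finsupp.add_apply, ha, hb]
    rw [hrepr, powForm_deltaOnes, deltaOnesCoeff_eq_factorial
      (isSubcomodule_initialSpan P i j c p) _ (rid_coord_coaction P i j c p (by rw [hp]; simp)) m _
      (Submodule.pow_mem_pow _ (Submodule.mem_map_of_mem (hmem p)) _)]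
    rw [map_pow, TensorAlgebra.lift_ι_apply, hcoord, one_pow, mul_one]
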